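/- **Setting.** An edge-to-edge pentagonal tiling of the unit sphere $S^2$ is a finite family of tiles covering $S^2$. Each tile is a closed topological disc whose boundary is divided by five corners into five sides (simple arcs, for example geodesic arcs). Distinct tiles do not overlap, a corner of one tile lies on another tile only as a corner of it, distinct tiles meet, apart from common corners, only in whole common sides, and every side belongs to exactly two tiles. At each of its corners each tile has an interior angle ($2\pi$ times the limit proportion of small discs around the corner that the tile occupies; for geodesic pentagons this is the usual angle). The tiles are angle congruent if any two of them have the same angle values in the same cyclic arrangement, up to rotation and reflection. The anglewise vertex combination (AVC) of the tiling records the number of tiles, the five angles of a tile, and the combinations of angles at the vertices with the number of vertices at which each occurs. For pairwise distinct angle values $\alpha,\beta,\gamma,\delta,\epsilon$ let $$\mathrm{AVC(5A24)}=\{24\alpha\beta\gamma\delta\epsilon:\ 24\alpha\beta\gamma,\ 8\delta^3,\ 6\epsilon^4\},$$ $$\mathrm{AVC(5A60)}=\{60\alpha\beta\gamma\delta\epsilon:\ 60\alpha\beta\gamma,\ 20\delta^3,\ 12\epsilon^5\},$$ $$\mathrm{AVC(5A36)}=\{36\alpha\beta\gamma\delta\epsilon:\ 36\alpha\beta\gamma,\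 8\delta^3,\ 12\delta\epsilon^3\};$$ the first means that there are $24$ tiles, each with the five angles $\alpha,\beta,\gamma,\delta,\epsilon$ in some arrangement, that the angles at exactly $24$ vertices are $\alpha,\beta,\gamma$, at exactly $8$ vertices $\delta,\delta,\delta$, at exactly $6$ vertices $\epsilon,\epsilon,\epsilon,\epsilon$, and that there are no other vertices; similarly for the other two. The pentagonal subdivision of the octahedron ($PP_8$) or of the icosahedron ($PP_{20}$) adds two vertices on each edge and one vertex in each face. On each edge $vw$ of a face, where $v$ precedes $w$ counterclockwise around the face, it joins the vertex in the face to the one of the two new vertices on the edge that is nearer to $v$. This divides each triangle into three pentagons. Angles are assigned to it as follows: in every pentagon the angle at the old vertex is $\epsilon$, the angle at the vertex in the face is $\delta$, and the other three angles are $\alpha,\beta,\gamma$ in some order, the same for all pentagons when read counterclockwise from the old vertex. **Theorem.** Let an edge-to-edge tiling of the sphere by angle congruent pentagons be given. 1. It has AVC(5A24) if and only if it is combinatorially isomorphic, angles included, to the pentagonal subdivision $PP_8$ of the octahedron with angles assigned as above for one of the orders of $\alpha,\beta,\gamma$. 2. It has AVC(5A60) if and only if it is combinatorially isomorphic, angles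 included, to the pentagonal subdivision $PP_{20}$ of the icosahedron with angles assigned as above for one of the orders of $\alpha,\beta,\gamma$. 3. It does not have AVC(5A36). -/

import Mathlib

open Set Filter Topology MeasureTheory

noncomputable section

/-- The unit sphere in Euclidean 3-space. -/
abbrev S2 : Type := Metric.sphere (0 : EuclideanSpace ℝ (Fin 3)) 1

/-- The area measure of the unit sphere. -/
def sphereArea : Measure S2 := (volume : Measure (EuclideanSpace ℝ (Fin 3))).toSphere

/-! ### Closed discs with five marked boundary points

The corners of a pentagon are indexed by `ZMod 5` in the cyclic order of its boundary, and
side `i` joins corner `i` to corner `i + 1`. -/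

/-- The closed unit disc, the parameter domain of a pentagonal tile. -/
def disc : Set ℂ := Metric.closedBall 0 1

/-- The open unit disc. -/
def openDisc : Set ℂ := Metric.ball 0 1

/-- The fifth root of unity `exp (2 π i k / 5)`, the model of corner `k`. -/
def discCorner (k : ZMod 5) : ℂ := (ZMod.toCircle k : ℂ)

/-- The arc of the unit circle from `discCorner k` counterclockwise to `discCorner (k + 1)`. -/
def discSide (k : ZMod 5) : Set ℂ :=
  (fun s : ℝ => discCorner k * (Circle.exp (2 * Real.pi * s / 5) : ℂ)) '' Icc 0 1

/-- A symmetry of the cyclic arrangement of the five corners of a pentagon: the rotation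
`i ↦ i + shift`, or the reflection `i ↦ shift - i`. -/
structure PentagonSymm where
  reflect : Bool
  shift : ZMod 5

/-- The action of a symmetry on the indices of the corners. -/
def PentagonSymm.onCorner (g : PentagonSymm) (i : ZMod 5) : ZMod 5 :=
  if g.reflect then g.shift - i else i + g.shift

/-- The action of a symmetry on the indices of the sides: since side `i` joins the corners `i` and
`i + 1`, a reflection sends it to the side that joins `shift - i - 1` and `shift - i`. -/
def PentagonSymm.onSide (g : PentagonSymm) (i : ZMod 5) : ZMod 5 :=
  if g.reflect then g.shift - i - 1 else i + g.shift

/-! ### Edge-to-edge tilings of the sphere by pentagons -/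

/-- An edge-to-edge tiling of the unit sphere by finitely many pentagons, with its angles.

A tile is a closed topological disc in the sphere whose boundary circle is divided by five corners
into five sides. The sides may be any simple arcs; geodesic polygons are the main special case. -/
structure SphereTiling where
  /-- the index set of the tiles -/
  Tile : Type
  [fintypeTile : Fintype Tile]
  /-- parametrization of each tile by the closed unit disc -/
  chart : Tile → ℂ → S2
  continuousOn_chart : ∀ t, ContinuousOn (chart t) disc
  injOn_chart : ∀ t, InjOn (chart t) disc
  /-- the tiles cover the sphere -/
  cover : ∀ p : S2, ∃ t, p ∈ chart t '' disc
  /-- distinct tiles do not overlap -/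
  no_overlap : ∀ t t', t ≠ t' → Disjoint (chart t '' openDisc) (chart t' '' disc)
  /-- a corner of one tile can lie on another tile only as a corner of that tile -/
  vertex_to_vertex : ∀ t t' i, chart t (discCorner i) ∈ chart t' '' disc →
    ∃ j, chart t' (discCorner j) = chart t (discCorner i)
  /-- distinct tiles meet, apart from common corners, in whole common sides only -/
  edge_to_edge : ∀ t t' p, t ≠ t' → p ∈ chart t '' disc → p ∈ chart t' '' disc →
    (∀ i, p ≠ chart t (discCorner i)) →
    ∃ i j, p ∈ chart t '' discSide i ∧ chart t '' discSide i = chart t' '' discSide j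
  /-- every side of a tile is a side of exactly one other tile -/
  two_sided : ∀ t i, ∃! t', t' ≠ t ∧ ∃ j, chart t' '' discSide j = chart t '' discSide i
  /-- the value of the interior angle of a tile at each of its corners -/
  angle : Tile → ZMod 5 → ℝ
  /-- The interior angle of a tile at a corner `p` is `2 π` times the limit proportion of small
  discs around `p` that the tile occupies. For sides with tangents at `p` this is the usual
  interior angle. -/
  angle_spec : ∀ t i,
    Tendsto (fun r : ℝ =>
        sphereArea.real (chart t '' disc ∩ Metric.ball (chart t (discCorner i)) r) /
          sphereArea.real (Metric.ball (chart t (discCorner i)) r))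
      (𝓝[>] 0) (𝓝 (angle t i / (2 * Real.pi)))

attribute [instance] SphereTiling.fintypeTile

/-- Corner `i` of tile `t`, a point of the sphere. -/
def SphereTiling.corner (T : SphereTiling) (t : T.Tile) (i : ZMod 5) : S2 :=
  T.chart t (discCorner i)

/-- Side `i` of tile `t`, an arc in the sphere. -/
def SphereTiling.side (T : SphereTiling) (t : T.Tile) (i : ZMod 5) : Set S2 :=
  T.chart t '' discSide i

/-- All tiles are angle congruent: any two have the same angle values, arranged in the same way
around the boundary, up to rotation and reflection. -/
def SphereTiling.AngleCongruent (T : SphereTiling) : Prop :=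
  ∀ t t', ∃ g : PentagonSymm, ∀ i, T.angle t i = T.angle t' (g.onCorner i)

/-! ### Anglewise vertex combinations -/

open Classical in
/-- The vertices of the tiling. -/
def SphereTiling.vertices (T : SphereTiling) : Finset S2 :=
  Finset.univ.image fun c : T.Tile × ZMod 5 => T.corner c.1 c.2

open Classical in
/-- The combination of the angles of all the tiles that meet at the point `p`. -/
def SphereTiling.vertexAngles (T : SphereTiling) (p : S2) : Multiset ℝ :=
  (Finset.univ.filter fun c : T.Tile × ZMod 5 => T.corner c.1 c.2 = p).val.map
    fun c => T.angle c.1 c.2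

/-- The data of an anglewise vertex combination: the number of tiles, the five angles of a tile
(in no particular order), and the angle combinations at the vertices, each with the number of
vertices at which it occurs. -/
structure AVC where
  numTiles : ℕ
  tileAngles : Multiset ℝ
  vertexTypes : Multiset (Multiset ℝ)

/-- `{24αβγδε : 24αβγ, 8δ³, 6ε⁴}` -/
def AVC5A24 (α β γ δ ε : ℝ) : AVC where
  numTiles := 24
  tileAngles := {α, β, γ, δ, ε}
  vertexTypes := Multiset.replicate 24 {α, β, γ} + Multiset.replicate 8 {δ, δ, δ}
    + Multiset.replicate 6 {ε, ε, ε, ε}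

/-- `{60αβγδε : 60αβγ, 20δ³, 12ε⁵}` -/
def AVC5A60 (α β γ δ ε : ℝ) : AVC where
  numTiles := 60
  tileAngles := {α, β, γ, δ, ε}
  vertexTypes := Multiset.replicate 60 {α, β, γ} + Multiset.replicate 20 {δ, δ, δ}
    + Multiset.replicate 12 {ε, ε, ε, ε, ε}

/-- `{36αβγδε : 36αβγ, 8δ³, 12δε³}` -/
def AVC5A36 (α β γ δ ε : ℝ) : AVC where
  numTiles := 36
  tileAngles := {α, β, γ, δ, ε}
  vertexTypes := Multiset.replicate 36 {α, β, γ} + Multiset.replicate 8 {δ, δ, δ}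
    + Multiset.replicate 12 {δ, ε, ε, ε}

/-- The tiling has the given anglewise vertex combination. -/
structure SphereTiling.HasAVC (T : SphereTiling) (A : AVC) : Prop where
  card_tile : Fintype.card T.Tile = A.numTiles
  tile_angles : ∀ t, Finset.univ.val.map (T.angle t) = A.tileAngles
  vertex_types : T.vertices.val.map T.vertexAngles = A.vertexTypes

/-! ### Combinatorial pentagonal tilings with angles, and pentagonal subdivision -/

/-- The combinatorial structure of a pentagonal tiling: its tiles, which vertex is corner `i` of a
tile, which edge is side `i` of a tile, and the angles. -/
structure AngledComplex where
  Tile : Type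
  Vertex : Type
  Edge : Type
  corner : Tile → ZMod 5 → Vertex
  side : Tile → ZMod 5 → Edge
  angle : Tile → ZMod 5 → ℝ

/-- The combinatorial structure of a tiling of the sphere. -/
def SphereTiling.complex (T : SphereTiling) : AngledComplex where
  Tile := T.Tile
  Vertex := S2
  Edge := Set S2
  corner := T.corner
  side := T.side
  angle := T.angle

/-- Two combinatorial pentagonal tilings are the same: there is a bijection `e` of the tiles and,
for each tile, a matching `g t` of its boundary with the boundary of the corresponding tile, such
that angles correspond, and corners (sides) are identified to one vertex (edge) in one tiling
exactly when the corresponding ones are identified in the other tiling. -/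
def AngledComplex.Isomorphic (A B : AngledComplex) : Prop :=
  ∃ (e : A.Tile ≃ B.Tile) (g : A.Tile → PentagonSymm),
    (∀ t i, A.angle t i = B.angle (e t) ((g t).onCorner i)) ∧
    (∀ t t' i j, A.corner t i = A.corner t' j ↔
      B.corner (e t) ((g t).onCorner i) = B.corner (e t') ((g t').onCorner j)) ∧
    (∀ t t' i j, A.side t i = A.side t' j ↔
      B.side (e t) ((g t).onSide i) = B.side (e t') ((g t').onSide j))

/-- A polyhedron with triangular faces, given by its vertices and its faces. The vertices of each
face are listed counterclockwise as seen from outside. -/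
structure TriangularPolyhedron where
  Vertex : Type
  Face : Type
  vert : Face → ZMod 3 → Vertex

/-- The vertices of the pentagonal subdivision: the old vertices, two new vertices on each edge
`vw` (`third v w` is the one nearer to `v`, `third w v` the one nearer to `w`), and a new vertex in
each face. -/
inductive SubdivVertex (P : TriangularPolyhedron) : Type
  | old (v : P.Vertex)
  | third (v w : P.Vertex)
  | center (f : P.Face)

/-- The corners of a tile of the pentagonal subdivision. The new vertex in the face `f` is joined,
for each edge `v w` of `f` (counterclockwise in `f`), to the nearer `third v w` of the two new
vertices on this edge. This divides `f` into pentagons, one at each vertex of `f`. With `u`, `v`,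
`w` consecutive counterclockwise, the pentagon at `v` goes
`v`, `third v w`, `center f`, `third u v`, `third v u`. -/
def TriangularPolyhedron.subdivCorner (P : TriangularPolyhedron) (t : P.Face × ZMod 3) :
    ZMod 5 → SubdivVertex P :=
  ![SubdivVertex.old (P.vert t.1 t.2),
    SubdivVertex.third (P.vert t.1 t.2) (P.vert t.1 (t.2 + 1)),
    SubdivVertex.center t.1,
    SubdivVertex.third (P.vert t.1 (t.2 - 1)) (P.vert t.1 t.2),
    SubdivVertex.third (P.vert t.1 t.2) (P.vert t.1 (t.2 - 1))]

/-- The pentagonal subdivision of a polyhedron with triangular faces; an edge is the unordered pair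
of its end points. In each tile, the angle at the old vertex is `ε`, at the new vertex in the face
`δ`, and the other three angles, in the order of `subdivCorner`, are `α`, `β`, `γ`. -/
def TriangularPolyhedron.pentagonalSubdivision (P : TriangularPolyhedron) (α β γ δ ε : ℝ) :
    AngledComplex where
  Tile := P.Face × ZMod 3
  Vertex := SubdivVertex P
  Edge := Sym2 (SubdivVertex P)
  corner := P.subdivCorner
  side := fun t i => s(P.subdivCorner t i, P.subdivCorner t (i + 1))
  angle := fun _ => ![ε, α, δ, β, γ]

/-- The vertices of the octahedron: two poles and four vertices on the equator. -/
inductive OctahedronVertex : Type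
  | north
  | south
  | equator (i : ZMod 4)

/-- The faces of the octahedron: four on either hemisphere. -/
inductive OctahedronFace : Type
  | upper (i : ZMod 4)
  | lower (i : ZMod 4)

open OctahedronVertex in
/-- The octahedron. -/
def octahedron : TriangularPolyhedron where
  Vertex := OctahedronVertex
  Face := OctahedronFace
  vert
    | .upper i => ![north, equator i, equator (i + 1)]
    | .lower i => ![south, equator (i + 1), equator i]

/-- The vertices of the icosahedron: two poles, five on an upper and five on a lower circle;
`down i` is adjacent to `up i` and `up (i + 1)`. -/
inductive IcosahedronVertex : Type
  | north
  | south
  | up (i : ZMod 5)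
  | down (i : ZMod 5)

/-- The faces of the icosahedron: five around each pole and ten in the middle belt. -/
inductive IcosahedronFace : Type
  | northCap (i : ZMod 5)
  | upperBelt (i : ZMod 5)
  | lowerBelt (i : ZMod 5)
  | southCap (i : ZMod 5)

open IcosahedronVertex in
/-- The icosahedron. -/
def icosahedron : TriangularPolyhedron where
  Vertex := IcosahedronVertex
  Face := IcosahedronFace
  vert
    | .northCap i => ![north, up i, up (i + 1)]
    | .upperBelt i => ![up i, down i, up (i + 1)]
    | .lowerBelt i => ![down i, down (i + 1), up (i + 1)]
    | .southCap i => ![south, down (i + 1), down i]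

/-- `PP₈`, the pentagonal subdivision of the octahedron, with its angles. -/
def PP8 (α β γ δ ε : ℝ) : AngledComplex := octahedron.pentagonalSubdivision α β γ δ ε

/-- `PP₂₀`, the pentagonal subdivision of the icosahedron, with its angles. -/
def PP20 (α β γ δ ε : ℝ) : AngledComplex := icosahedron.pentagonalSubdivision α β γ δ ε

end

/-! The angles force the gluing. The corners of each tile can be numbered so that corner 0 is `ε`
and, after a reflection if needed, `δ` is corner 1 or 2 (`exists_reindex`). The five angles being
distinct, the angles at a vertex tell which corners meet there. Topology enters only through
`IsGlued`: sides are shared in pairs, the tiles around a vertex form one cycle, and the tiling is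
connected.

For 5A24 and 5A60, `δ` cannot be adjacent to `ε`: the side from `δ` to its other neighbour would be
glued to its own copy, and an angle would occur twice at a vertex `αβγ`. With `δ` at corner 2, side
0 must be glued to side 4, side 1 to side 2 and side 3 to side 3. Crossing sides 1 and 3 gives
permutations `y`, `z` of the tiles with `y³ = z² = 1`. The vertices `αβγ` make `zy` the rotation
about `ε`, so `(zy)ⁿ = 1` with `n = 4` or `5`. The triangle group `(2, 3, n)` thus acts transitively
on the tiles, and its action determines which corners and sides coincide (`corner_eq_iff`,
`side_eq_iff`). Its orbits have at most 24 or 60 elements (`exists_orbit_octahedral`,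
`exists_orbit_icosahedral`), which is the number of tiles. The orbit of a pair (tile of the tiling,
tile of the model) is therefore the graph of an equivariant bijection (`exists_equivariant_equiv`),
and this is the isomorphism. Conversely, an isomorphism preserves the corners at each vertex, and
double counting gives the multiplicities (`hasAVC_of_isomorphic`).

For 5A36, if `δ` is adjacent to `ε`, every corner `δ` meets a corner `ε`, so there is no vertex
`δ³`. Otherwise the three tiles around a vertex `δ³` would alternate between two kinds, which is
impossible since three is odd (`false_of_mixed_vertex`). -/

noncomputable section

/-! ### Combinatorial properties of tilings -/

/-- Distinct faces are glued along whole sides, each side to exactly one other; the tiles around a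
vertex form a single cycle, and the whole complex is connected. -/
structure AngledComplex.IsGlued (A : AngledComplex) : Prop where
  corner_inj : ∀ t, Function.Injective (A.corner t)
  exists_glue : ∀ t i, ∃ t' j, t' ≠ t ∧ A.side t i = A.side t' j
  glue_unique : ∀ t i t₁ t₂ j₁ j₂, t₁ ≠ t → t₂ ≠ t → A.side t i = A.side t₁ j₁ →
    A.side t i = A.side t₂ j₂ → t₁ = t₂
  endpoints : ∀ t i t' j, A.side t i = A.side t' j →
    s(A.corner t i, A.corner t (i + 1)) = s(A.corner t' j, A.corner t' (j + 1))
  link : ∀ (p : A.Vertex) (S : Set A.Tile), (∃ t ∈ S, ∃ i, A.corner t i = p) →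
    (∀ t ∈ S, ∀ i t' j, (A.corner t i = p ∨ A.corner t (i + 1) = p) →
      A.side t i = A.side t' j → t' ∈ S) →
    ∀ t' i, A.corner t' i = p → t' ∈ S
  connected : ∀ S : Set A.Tile, S.Nonempty →
    (∀ t ∈ S, ∀ t' i j, A.corner t i = A.corner t' j → t' ∈ S) → ∀ t, t ∈ S

/-! ### The model disc -/

lemma norm_discCorner (k : ZMod 5) : ‖discCorner k‖ = 1 := Circle.norm_coe _

lemma discCorner_mem_disc (k : ZMod 5) : discCorner k ∈ disc := by
  simp [disc, norm_discCorner]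

lemma discCorner_injective : Function.Injective discCorner := fun _ _ h =>
  ZMod.injective_toCircle (Subtype.ext h)

lemma discSide_subset_disc (k : ZMod 5) : discSide k ⊆ disc := by
  rintro _ ⟨s, -, rfl⟩
  rw [disc, mem_closedBall_zero_iff, norm_mul, norm_discCorner, Circle.norm_coe, one_mul]

lemma discCorner_add (k l : ZMod 5) : discCorner (k + l) = discCorner k * discCorner l := by
  simp [discCorner, AddChar.map_add_eq_mul]

lemma discCorner_eq_exp (k : ZMod 5) :
    discCorner k = (Circle.exp (2 * Real.pi * k.val / 5) : ℂ) := by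
  rw [discCorner, ZMod.toCircle_apply, Circle.coe_exp]
  congr 1
  push_cast
  ring

lemma isCompact_discSide (k : ZMod 5) : IsCompact (discSide k) := by
  apply isCompact_Icc.image
  fun_prop

lemma discCorner_mem_discSide_iff (k i : ZMod 5) :
    discCorner k ∈ discSide i ↔ k = i ∨ k = i + 1 := by
  obtain ⟨d, rfl⟩ : ∃ d, k = i + d := ⟨k - i, by ring⟩
  constructor
  · rintro ⟨s, ⟨hs0, hs1⟩, h⟩
    simp only [discCorner_add] at h
    have h0 : discCorner i ≠ 0 := by
      intro h0
      have := norm_discCorner i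
      simp [h0] at this
    have h1 := mul_left_cancel₀ h0 h
    rw [discCorner_eq_exp] at h1
    obtain ⟨m, hm⟩ := Circle.exp_eq_exp.1 (Subtype.ext h1)
    have hpi := Real.pi_pos
    -- A full turn is five units of `s`, so `s` and `d` differ by a multiple of 5; then `0 ≤ s ≤ 1`
    -- leaves only `d = 0` and `d = 1`.
    have h2 : s = d.val + 5 * m := by
      have h3 : 2 * Real.pi * (s - (d.val + 5 * m)) = 0 := by
        have : 2 * Real.pi * s / 5 * 5 = (2 * Real.pi * d.val / 5 + m * (2 * Real.pi)) * 5 := by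
          rw [hm]
        linarith
      have := (mul_eq_zero.1 h3).resolve_left (by positivity)
      linarith
    have hd : d.val < 5 := ZMod.val_lt d
    have h4 : (0 : ℤ) ≤ d.val + 5 * m := by
      have : (0 : ℝ) ≤ ((d.val + 5 * m : ℤ) : ℝ) := by push_cast; linarith
      exact_mod_cast this
    have h5 : (d.val : ℤ) + 5 * m ≤ 1 := by
      have : ((d.val + 5 * m : ℤ) : ℝ) ≤ 1 := by push_cast; linarith
      exact_mod_cast this
    have h6 : d.val = 0 ∨ d.val = 1 := by omega
    revert h6
    clear * -
    revert i d
    decide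
  · intro h
    have h' : d = 0 ∨ d = 1 := by
      rcases h with h | h
      · left; simpa using h
      · right; simpa using h
    rcases h' with rfl | rfl
    · exact ⟨0, by simp, by simp⟩
    · refine ⟨1, by simp, ?_⟩
      rw [discCorner_add, discCorner_eq_exp 1]
      have : (1 : ZMod 5).val = 1 := rfl
      simp [this]

/-! ### Tilings of the sphere are glued complexes -/

namespace SphereTiling

variable (T : SphereTiling)

lemma corner_injective (t : T.Tile) : Function.Injective (T.corner t) := fun _ _ h =>
  discCorner_injective (T.injOn_chart t (discCorner_mem_disc _) (discCorner_mem_disc _) h)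

lemma corner_mem_side_iff (t : T.Tile) (k i : ZMod 5) :
    T.corner t k ∈ T.side t i ↔ k = i ∨ k = i + 1 := by
  rw [← discCorner_mem_discSide_iff]
  constructor
  · rintro ⟨z, hz, h⟩
    rwa [← T.injOn_chart t (discSide_subset_disc i hz) (discCorner_mem_disc k) h]
  · exact fun h => ⟨_, h, rfl⟩

lemma side_subset (t : T.Tile) (i : ZMod 5) : T.side t i ⊆ T.chart t '' disc :=
  image_mono (discSide_subset_disc i)

lemma corner_mem_tile (t : T.Tile) (i : ZMod 5) : T.corner t i ∈ T.chart t '' disc :=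
  ⟨_, discCorner_mem_disc i, rfl⟩

lemma isClosed_tile (t : T.Tile) : IsClosed (T.chart t '' disc) :=
  ((isCompact_closedBall _ _).image_of_continuousOn (T.continuousOn_chart t)).isClosed

lemma isClosed_side (t : T.Tile) (i : ZMod 5) : IsClosed (T.side t i) :=
  ((isCompact_discSide i).image_of_continuousOn
    ((T.continuousOn_chart t).mono (discSide_subset_disc i))).isClosed

/-- The corners on a side are its two end points. -/
lemma corner_mem_side_iff_of_eq {t t' : T.Tile} {i j : ZMod 5} (h : T.side t i = T.side t' j)
    (p : S2) : (p = T.corner t i ∨ p = T.corner t (i + 1)) →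
      (p = T.corner t' j ∨ p = T.corner t' (j + 1)) := by
  intro hp
  have hmem : p ∈ T.side t i := by
    rcases hp with rfl | rfl
    · exact (T.corner_mem_side_iff t _ i).2 (Or.inl rfl)
    · exact (T.corner_mem_side_iff t _ i).2 (Or.inr rfl)
  obtain ⟨k, hk⟩ : ∃ k, T.corner t' k = p := by
    have hm : p ∈ T.chart t' '' disc := T.side_subset t' j (h ▸ hmem)
    rcases hp with rfl | rfl
    · exact T.vertex_to_vertex t t' _ hm
    · exact T.vertex_to_vertex t t' _ hm
  rw [h, ← hk, T.corner_mem_side_iff] at hmem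
  rcases hmem with rfl | rfl
  · exact Or.inl hk.symm
  · exact Or.inr hk.symm

lemma endpoints_eq {t t' : T.Tile} {i j : ZMod 5} (h : T.side t i = T.side t' j) :
    s(T.corner t i, T.corner t (i + 1)) = s(T.corner t' j, T.corner t' (j + 1)) := by
  ext p
  simp only [Sym2.mem_iff]
  exact ⟨T.corner_mem_side_iff_of_eq h p, T.corner_mem_side_iff_of_eq h.symm p⟩

/-- The sphere is connected and the tiles are closed and finite in number, so some tile in `S` meets
some tile outside. Tiles that meet share a corner: the meeting point itself or an end of a common
side. -/
lemma tile_connected (S : Set T.Tile) (hS : S.Nonempty)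
    (hcl : ∀ t ∈ S, ∀ t' i j, T.corner t i = T.corner t' j → t' ∈ S) (t : T.Tile) : t ∈ S := by
  have hmeet : ∀ t ∈ S, ∀ t', (T.chart t '' disc ∩ T.chart t' '' disc).Nonempty → t' ∈ S := by
    rintro t ht t' ⟨p, hp, hp'⟩
    by_cases hne : t = t'
    · exact hne ▸ ht
    by_cases hc : ∃ i, p = T.corner t i
    · obtain ⟨i, rfl⟩ := hc
      obtain ⟨j, hj⟩ := T.vertex_to_vertex t t' i hp'
      exact hcl t ht t' i j hj.symm
    · push Not at hc
      obtain ⟨i, j, -, hs⟩ := T.edge_to_edge t t' p hne hp hp' hc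
      rcases T.corner_mem_side_iff_of_eq hs _ (Or.inl rfl) with h | h
      · exact hcl t ht t' _ _ h
      · exact hcl t ht t' _ _ h
  by_contra ht
  have hrank : 1 < Module.rank ℝ (EuclideanSpace ℝ (Fin 3)) := by
    apply Module.lt_rank_of_lt_finrank; simp
  have hconn : IsPreconnected (univ : Set S2) := by
    have := isPreconnected_sphere hrank 0 1
    rwa [isPreconnected_iff_preconnectedSpace, preconnectedSpace_iff_univ] at this
  rw [isPreconnected_closed_iff] at hconn
  obtain ⟨t₀, ht₀⟩ := hS
  obtain ⟨p, -, hp, hp'⟩ := hconn (⋃ t ∈ S, T.chart t '' disc) (⋃ t ∈ Sᶜ, T.chart t '' disc)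
    ((toFinite S).isClosed_biUnion fun t _ => T.isClosed_tile t)
    ((toFinite Sᶜ).isClosed_biUnion fun t _ => T.isClosed_tile t)
    (fun p _ => by
      obtain ⟨t, ht⟩ := T.cover p
      by_cases h : t ∈ S
      · exact Or.inl (mem_biUnion h ht)
      · exact Or.inr (mem_biUnion h ht))
    ⟨T.corner t₀ 0, mem_univ _, mem_biUnion ht₀ (T.corner_mem_tile t₀ 0)⟩
    ⟨T.corner t 0, mem_univ _, mem_biUnion (show t ∈ Sᶜ from ht) (T.corner_mem_tile t 0)⟩
  simp only [mem_iUnion] at hp hp'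
  obtain ⟨t₁, h₁, hp₁⟩ := hp
  obtain ⟨t₂, h₂, hp₂⟩ := hp'
  exact h₂ (hmeet t₁ h₁ t₂ ⟨p, hp₁, hp₂⟩)

end SphereTiling

/-- Every neighbourhood of a point of the sphere contains one that stays connected when the point
is removed. -/
lemma exists_punctured_nhds_preconnected (p : S2) {W : Set S2} (hW : W ∈ 𝓝 p) :
    ∃ U ⊆ W, U ∈ 𝓝 p ∧ IsPreconnected (U \ {p}) := by
  have : Fact (Module.finrank ℝ (EuclideanSpace ℝ (Fin 3)) = 2 + 1) := ⟨by simp⟩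
  -- Projecting from `-p` puts `p` in the domain.
  set φ := stereographic' 2 (-p) with hφ
  have hp : p ∈ φ.source := by
    rw [hφ, stereographic'_source]
    exact fun h => ne_neg_of_mem_unit_sphere ℝ p h
  have htarget : φ.target = univ := stereographic'_target (-p)
  have hsymm : Continuous φ.symm := by
    have := φ.continuousOn_symm
    rwa [htarget, continuousOn_univ] at this
  have hW' : φ.symm ⁻¹' W ∈ 𝓝 (φ p) := by
    apply hsymm.continuousAt
    rwa [φ.left_inv hp]
  obtain ⟨r, hr, hball⟩ := Metric.mem_nhds_iff.1 hW'
  refine ⟨φ.symm '' Metric.ball (φ p) r, ?_, ?_, ?_⟩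
  · rintro _ ⟨y, hy, rfl⟩
    exact hball hy
  · have := φ.symm.image_mem_nhds (x := φ p) (by simp [htarget])
      (Metric.ball_mem_nhds (φ p) hr)
    rwa [φ.left_inv hp] at this
  · have hrank : 1 < Module.rank ℝ (EuclideanSpace ℝ (Fin 2)) := by
      apply Module.lt_rank_of_lt_finrank; simp
    -- Polar coordinates: a punctured plane disc is the image of circle times interval.
    have hprod : IsPreconnected
        ((Metric.sphere (0 : EuclideanSpace ℝ (Fin 2)) 1) ×ˢ (Ioo 0 r)) :=
      (isPreconnected_sphere hrank 0 1).prod isPreconnected_Ioo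
    have himg := hprod.image (fun q => φ.symm (φ p + q.2 • q.1))
      (by apply Continuous.continuousOn; fun_prop)
    convert himg using 1
    ext q
    constructor
    · rintro ⟨⟨y, hy, rfl⟩, hq⟩
      have hne : y - φ p ≠ 0 := by
        intro h
        apply hq
        rw [sub_eq_zero.1 h, φ.left_inv hp]
        rfl
      have hn : 0 < ‖y - φ p‖ := norm_pos_iff.2 hne
      refine ⟨(‖y - φ p‖⁻¹ • (y - φ p), ‖y - φ p‖), ⟨?_, hn, ?_⟩, ?_⟩
      · simp [norm_smul, hn.ne']
      · rwa [← dist_eq_norm]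
      · simp [smul_smul, hn.ne']
    · rintro ⟨⟨u, s⟩, ⟨hu, hs0, hsr⟩, rfl⟩
      have hu' : ‖u‖ = 1 := by simpa using hu
      simp only at hs0 hsr
      refine ⟨⟨_, ?_, rfl⟩, ?_⟩
      · simpa [norm_smul, hu', abs_of_pos hs0] using hsr
      · intro h
        have h1 := congrArg φ (mem_singleton_iff.1 h)
        rw [φ.right_inv (by simp [htarget])] at h1
        have h2 : s • u = 0 := by simpa using h1
        rcases smul_eq_zero.1 h2 with h3 | h3
        · exact hs0.ne' h3
        · simp [h3] at hu'

/-! ### The cycle of tiles around a vertex -/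

namespace SphereTiling

variable (T : SphereTiling)

/-- A tile accumulates at each of its corners. -/
lemma tile_inter_nhds_nonempty (t : T.Tile) (i : ZMod 5) {U : Set S2}
    (hU : U ∈ 𝓝 (T.corner t i)) : ((U \ {T.corner t i}) ∩ T.chart t '' disc).Nonempty := by
  have hc := (T.continuousOn_chart t) _ (discCorner_mem_disc i)
  have hpre : T.chart t ⁻¹' U ∈ 𝓝[disc] (discCorner i) := hc hU
  have hlim : Tendsto (fun s : ℝ => (s : ℂ) * discCorner i) (𝓝[<] 1) (𝓝[disc] (discCorner i)) := by
    apply tendsto_nhdsWithin_of_tendsto_nhds_of_eventually_within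
    · have : Continuous (fun s : ℝ => (s : ℂ) * discCorner i) := by fun_prop
      have h1 := this.tendsto 1
      simp only [Complex.ofReal_one, one_mul] at h1
      exact h1.mono_left nhdsWithin_le_nhds
    · filter_upwards [Ioo_mem_nhdsLT (zero_lt_one' ℝ)] with s hs
      simp [disc, norm_discCorner, abs_of_pos hs.1, hs.2.le]
  have hev : ∀ᶠ s : ℝ in 𝓝[<] 1, (s : ℂ) * discCorner i ∈ disc ∧
      T.chart t ((s : ℂ) * discCorner i) ∈ U :=
    (hlim.eventually eventually_mem_nhdsWithin).and (hlim.eventually hpre)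
  obtain ⟨s, ⟨hs1, hs2⟩, hs3⟩ := (hev.and (Ioo_mem_nhdsLT (zero_lt_one' ℝ))).exists
  refine ⟨_, ⟨hs2, ?_⟩, _, hs1, rfl⟩
  intro h
  have h1 := congrArg norm (T.injOn_chart t hs1 (discCorner_mem_disc i) h)
  simp only [Complex.norm_mul, norm_discCorner, Complex.norm_real, mul_one, Real.norm_eq_abs,
    abs_of_pos hs3.1] at h1
  exact hs3.2.ne h1

/-- The tiles around a vertex form a single cycle. -/
lemma vertex_link (p : S2) (S : Set T.Tile) (hS : ∃ t ∈ S, ∃ i, T.corner t i = p)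
    (hcl : ∀ t ∈ S, ∀ i t' j, (T.corner t i = p ∨ T.corner t (i + 1) = p) →
      T.side t i = T.side t' j → t' ∈ S)
    (t' : T.Tile) (i' : ZMod 5) (hp : T.corner t' i' = p) : t' ∈ S := by
  by_contra ht'
  obtain ⟨t, ht, i, hi⟩ := hS
  -- Off the closed set `Z`, every tile, side or corner that occurs passes through `p`.
  let Z : Set S2 := (⋃ t ∈ {t | p ∉ T.chart t '' disc}, T.chart t '' disc) ∪
    (⋃ c ∈ {c : T.Tile × ZMod 5 | p ∉ T.side c.1 c.2}, T.side c.1 c.2) ∪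
    (⋃ c ∈ {c : T.Tile × ZMod 5 | p ≠ T.corner c.1 c.2}, {T.corner c.1 c.2})
  have hZ : IsClosed Z := by
    refine IsClosed.union (IsClosed.union ?_ ?_) ?_
    · exact (toFinite _).isClosed_biUnion fun t _ => T.isClosed_tile t
    · exact (toFinite _).isClosed_biUnion fun c _ => T.isClosed_side _ _
    · exact (toFinite _).isClosed_biUnion fun c _ => isClosed_singleton
  have hpZ : p ∉ Z := by
    simp only [Z, mem_union, mem_iUnion, not_or, not_exists]
    exact ⟨⟨fun t h h' => h h', fun t h h' => h h'⟩, fun t h h' => h h'⟩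
  obtain ⟨U, hUZ, hU, hconn⟩ := exists_punctured_nhds_preconnected p (hZ.isOpen_compl.mem_nhds hpZ)
  rw [isPreconnected_closed_iff] at hconn
  obtain ⟨q, ⟨hqU, hqp⟩, hq, hq'⟩ := hconn
    (⋃ t ∈ S, T.chart t '' disc) (⋃ t ∈ Sᶜ, T.chart t '' disc)
    ((toFinite S).isClosed_biUnion fun t _ => T.isClosed_tile t)
    ((toFinite Sᶜ).isClosed_biUnion fun t _ => T.isClosed_tile t)
    (fun p _ => by
      obtain ⟨t, ht⟩ := T.cover p
      by_cases h : t ∈ S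
      · exact Or.inl (mem_biUnion h ht)
      · exact Or.inr (mem_biUnion h ht))
    (by
      obtain ⟨q, hq, hq'⟩ := T.tile_inter_nhds_nonempty t i (hi ▸ hU)
      exact ⟨q, hi ▸ hq, mem_biUnion ht hq'⟩)
    (by
      obtain ⟨q, hq, hq'⟩ := T.tile_inter_nhds_nonempty t' i' (hp ▸ hU)
      exact ⟨q, hp ▸ hq, mem_biUnion (show t' ∈ Sᶜ from ht') hq'⟩)
  have hqZ : q ∉ Z := hUZ hqU
  simp only [Z, mem_union, mem_iUnion, not_or, not_exists, mem_ofPred_eq, exists_prop, not_and,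
    Prod.forall, mem_singleton_iff] at hqZ
  simp only [mem_iUnion] at hq hq'
  obtain ⟨t₁, h₁, hq₁⟩ := hq
  obtain ⟨t₂, h₂, hq₂⟩ := hq'
  have hne : t₁ ≠ t₂ := fun h => h₂ (h ▸ h₁)
  have hcorner : ∀ i, q ≠ T.chart t₁ (discCorner i) := by
    intro k hk
    by_cases hpk : p = T.corner t₁ k
    · exact hqp (hk.trans hpk.symm)
    · exact hqZ.2 t₁ k hpk hk
  obtain ⟨k, l, hqk, hkl⟩ := T.edge_to_edge t₁ t₂ q hne hq₁ hq₂ hcorner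
  -- The common side contains `q ∉ Z`, so it contains `p`; being a corner, `p` is then one of its
  -- ends, and `hcl` applies.
  have hpk : p ∈ T.side t₁ k := by
    by_contra h
    exact hqZ.1.2 t₁ k h hqk
  obtain ⟨m, hm⟩ : ∃ m, T.corner t₁ m = p := by
    subst hp
    exact T.vertex_to_vertex t' t₁ i' (T.side_subset t₁ k hpk)
  rw [← hm, T.corner_mem_side_iff] at hpk
  refine h₂ (hcl t₁ h₁ k t₂ l ?_ hkl)
  rcases hpk with rfl | rfl
  · exact Or.inl hm
  · exact Or.inr hm

lemma isGlued_complex : T.complex.IsGlued where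
  corner_inj := T.corner_injective
  exists_glue t i := by
    obtain ⟨t', ⟨hne, j, hj⟩, -⟩ := T.two_sided t i
    exact ⟨t', j, hne, hj.symm⟩
  glue_unique t i t₁ t₂ j₁ j₂ h₁ h₂ hs₁ hs₂ :=
    (T.two_sided t i).unique ⟨h₁, j₁, hs₁.symm⟩ ⟨h₂, j₂, hs₂.symm⟩
  endpoints _ _ _ _ h := T.endpoints_eq h
  link := T.vertex_link
  connected := T.tile_connected

end SphereTiling

/-! ### Gluing around labelled vertices -/

lemma ZMod.five_cases (i : ZMod 5) : i = 0 ∨ i = 1 ∨ i = 2 ∨ i = 3 ∨ i = 4 := by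
  revert i; decide

lemma Equiv.Perm.SameCycle.apply_eq_of_invariant {X Y : Type*} {f : Equiv.Perm X} {g : X → Y}
    (hg : ∀ t, g (f t) = g t) {a b : X} (h : f.SameCycle a b) : g a = g b := by
  obtain ⟨k, rfl⟩ := h
  induction k with
  | zero => rfl
  | succ k ih => rw [ih, zpow_add, zpow_one, (Commute.refl f).zpow_left k |>.eq,
      Equiv.Perm.mul_apply, hg]
  | pred k ih =>
    rw [ih]
    have : (f ^ (-(k : ℤ))) a = f ((f ^ (-(k : ℤ) - 1)) a) := by
      rw [← Equiv.Perm.mul_apply, ← zpow_one_add]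
      congr 2
      ring
    rw [this, hg]

namespace AngledComplex

variable {A : AngledComplex}

/-- If `f` crosses side `a` at corner `k`, and side `a` of a tile is side `b` of the next, then `f`
rotates around the vertices at corners `k`. -/
lemma IsGlued.sameCycle_iff (hA : A.IsGlued) {f : Equiv.Perm A.Tile} {k a b : ZMod 5}
    (hne : ∀ t, f t ≠ t) (hside : ∀ t, A.side t a = A.side (f t) b)
    (hcor : ∀ t, A.corner (f t) k = A.corner t k)
    (hk : ∀ t t' i, A.corner t k = A.corner t' i → i = k)
    (hab : ∀ i, (i = k ∨ i + 1 = k) → i = a ∨ i = b) (t t' : A.Tile) :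
    A.corner t k = A.corner t' k ↔ f.SameCycle t t' := by
  constructor
  · intro h
    -- The cycle of `t` is closed under crossing the sides at the vertex: side `a` leads to `f u`,
    -- side `b` to `f⁻¹ u`.
    refine hA.link (A.corner t k) {u | f.SameCycle t u} ⟨t, Equiv.Perm.SameCycle.refl _ _, k, rfl⟩
      ?_ t' k h.symm
    rintro u (hu : f.SameCycle t u) i u' j hi hs
    show f.SameCycle t u'
    by_cases hu' : u' = u
    · rwa [hu']
    have hi' : i = k ∨ i + 1 = k := hi.imp (fun h => hk _ _ _ h.symm) (fun h => hk _ _ _ h.symm)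
    rcases hab i hi' with rfl | rfl
    · rw [hA.glue_unique u i u' (f u) j b hu' (hne u) hs (hside u)]
      exact Equiv.Perm.sameCycle_apply_right.2 hu
    · have h1 : f.symm u ≠ u := fun h => hne u (by rw [Equiv.symm_apply_eq] at h; exact h.symm)
      have h2 : A.side u i = A.side (f.symm u) a := by rw [hside, f.apply_symm_apply]
      rw [hA.glue_unique u i u' (f.symm u) j a hu' h1 hs h2]
      exact Equiv.Perm.sameCycle_apply_right.1 (by rwa [f.apply_symm_apply])
  · intro h
    exact h.apply_eq_of_invariant (g := fun t => A.corner t k) hcor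

/-- The tiles with corner `k` at a given vertex form one cycle of `f` of length `n`, so `f ^ n`
fixes each of them. -/
lemma pow_ncard_eq_one [Finite A.Tile] {f : Equiv.Perm A.Tile} {k : ZMod 5} {n : ℕ}
    (hf : ∀ t t', A.corner t k = A.corner t' k ↔ f.SameCycle t t')
    (hn : ∀ t, {t' | A.corner t' k = A.corner t k}.ncard = n) : f ^ n = 1 := by
  ext t
  set s : Set A.Tile := {t' | A.corner t' k = A.corner t k} with hs
  have hcyc : f.IsCycleOn s := by
    refine ⟨⟨fun u hu => ?_, f.injective.injOn, fun u hu => ⟨f.symm u, ?_, by simp⟩⟩, ?_⟩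
    · exact ((hf _ _).2 (Equiv.Perm.sameCycle_apply_left.2 (Equiv.Perm.SameCycle.refl f u))).trans hu
    · exact ((hf _ _).2 (Equiv.Perm.sameCycle_apply_left.1
        (by rw [f.apply_symm_apply]))).trans hu
    · intro u hu v hv
      exact (hf u v).1 (hu.trans hv.symm)
  have hfin : s.Finite := toFinite s
  have hpow := Equiv.Perm.IsCycleOn.pow_card_apply (f := f) (a := t) (s := hfin.toFinset)
    (by simpa using hcyc) (by simp [hs])
  rw [← ncard_eq_toFinset_card s hfin, hn] at hpow
  simpa using hpow

/-- The corners at a vertex are all of one kind; where the kind is `1`, at most one tile has a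
given corner there. -/
structure HasKinds (A : AngledComplex) (kind : ZMod 5 → Fin 3) : Prop where
  kind_eq : ∀ {t t' i j}, A.corner t i = A.corner t' j → kind i = kind j
  tile_eq : ∀ {t t' i}, A.corner t i = A.corner t' i → kind i = 1 → t = t'

/-- The tiles of a pentagonal subdivision: the permutation `y` rotates around corner 2, `z` crosses
side 3, `z * y` rotates around corner 0, and corners 1, 3, 4 of three tiles meet. -/
structure IsSubdivision (A : AngledComplex) (n : ℕ) (y z : Equiv.Perm A.Tile) : Prop where
  kinds : A.HasKinds ![0, 1, 2, 1, 1]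
  z_mul_z : z * z = 1
  y_pow : y ^ 3 = 1
  zy_pow : (z * y) ^ n = 1
  corner_zero : ∀ t t', A.corner t 0 = A.corner t' 0 ↔ (z * y).SameCycle t t'
  corner_two : ∀ t t', A.corner t 2 = A.corner t' 2 ↔ y.SameCycle t t'
  corner_one_three : ∀ t, A.corner t 1 = A.corner (y t) 3
  corner_one_four : ∀ t, A.corner t 1 = A.corner ((z * y) t) 4
  side_eq_iff : ∀ t t' i j, A.side t i = A.side t' j ↔
    s(A.corner t i, A.corner t (i + 1)) = s(A.corner t' j, A.corner t' (j + 1))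

/-- This is the case of `δ` at corner 1. Side 1 is the only side joining kinds 2 and 1, so it is
glued to side 1 of another tile; both tiles then have corner 2 at one vertex, against `tile_eq`. -/
lemma IsGlued.false_of_adjacent (hA : A.IsGlued) (hk : A.HasKinds ![0, 2, 1, 1, 1]) (t : A.Tile) :
    False := by
  obtain ⟨t', j, hne, hs⟩ := hA.exists_glue t 1
  have hends := hA.endpoints _ _ _ _ hs
  rw [Sym2.eq_iff] at hends
  rcases ZMod.five_cases j with rfl | rfl | rfl | rfl | rfl <;>
    rcases hends with ⟨h1, h2⟩ | ⟨h1, h2⟩ <;>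
    first
      | exact absurd (hk.kind_eq h1) (by decide)
      | exact absurd (hk.kind_eq h2) (by decide)
      | exact absurd (hk.tile_eq h2 (by decide)) hne.symm

/-- The kinds of the ends, and uniqueness at kind 1, leave one gluing: side 0 to 4, side 1 to 2,
side 3 to 3 reversed. Crossing sides 0, 1, 3 gives `x`, `y`, `z`. -/
theorem IsGlued.exists_isSubdivision [Finite A.Tile] (hA : A.IsGlued)
    (hk : A.HasKinds ![0, 1, 2, 1, 1]) {n : ℕ}
    (h0 : ∀ t, {t' | A.corner t' 0 = A.corner t 0}.ncard = n)
    (h2 : ∀ t, {t' | A.corner t' 2 = A.corner t 2}.ncard = 3) :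
    ∃ y z, A.IsSubdivision n y z := by
  have e1 : (1 : ZMod 5) + 1 = 2 := rfl
  have e2 : (2 : ZMod 5) + 1 = 3 := rfl
  have e3 : (3 : ZMod 5) + 1 = 4 := rfl
  have e4 : (4 : ZMod 5) + 1 = 0 := rfl
  have hx : ∀ t, ∃ t', t' ≠ t ∧ A.side t 0 = A.side t' 4 ∧ A.corner t 0 = A.corner t' 0 ∧
      A.corner t 1 = A.corner t' 4 := by
    intro t
    obtain ⟨t', j, hne, hs⟩ := hA.exists_glue t 0
    have hends := hA.endpoints _ _ _ _ hs
    rw [Sym2.eq_iff] at hends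
    rcases ZMod.five_cases j with rfl | rfl | rfl | rfl | rfl <;>
      simp only [zero_add, e1, e2, e3, e4] at hends <;>
      rcases hends with ⟨h1, h2⟩ | ⟨h1, h2⟩ <;>
      first
        | exact absurd (hk.kind_eq h1) (by decide)
        | exact absurd (hk.kind_eq h2) (by decide)
        | exact absurd (hk.tile_eq h2 (by decide)) hne.symm
        | exact ⟨t', hne, hs, h1, h2⟩
  have hy : ∀ t, ∃ t', t' ≠ t ∧ A.side t 1 = A.side t' 2 ∧ A.corner t 1 = A.corner t' 3 ∧
      A.corner t 2 = A.corner t' 2 := by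
    intro t
    obtain ⟨t', j, hne, hs⟩ := hA.exists_glue t 1
    have hends := hA.endpoints _ _ _ _ hs
    rw [Sym2.eq_iff] at hends
    rcases ZMod.five_cases j with rfl | rfl | rfl | rfl | rfl <;>
      simp only [zero_add, e1, e2, e3, e4] at hends <;>
      rcases hends with ⟨h1, h2⟩ | ⟨h1, h2⟩ <;>
      first
        | exact absurd (hk.kind_eq h1) (by decide)
        | exact absurd (hk.kind_eq h2) (by decide)
        | exact absurd (hk.tile_eq h1 (by decide)) hne.symm
        | exact ⟨t', hne, hs, h1, h2⟩
  have hz : ∀ t, ∃ t', t' ≠ t ∧ A.side t 3 = A.side t' 3 ∧ A.corner t 3 = A.corner t' 4 ∧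
      A.corner t 4 = A.corner t' 3 := by
    intro t
    obtain ⟨t', j, hne, hs⟩ := hA.exists_glue t 3
    have hends := hA.endpoints _ _ _ _ hs
    rw [Sym2.eq_iff] at hends
    rcases ZMod.five_cases j with rfl | rfl | rfl | rfl | rfl <;>
      simp only [zero_add, e1, e2, e3, e4] at hends <;>
      rcases hends with ⟨h1, h2⟩ | ⟨h1, h2⟩ <;>
      first
        | exact absurd (hk.kind_eq h1) (by decide)
        | exact absurd (hk.kind_eq h2) (by decide)
        | exact absurd (hk.tile_eq h1 (by decide)) hne.symm
        | exact ⟨t', hne, hs, h1, h2⟩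
  choose x hxne hxs hx0 hx1 using hx
  choose y hyne hys hy1 hy2 using hy
  choose z hzne hzs hz3 hz4 using hz
  have hzz : ∀ t, z (z t) = t := fun t =>
    (hk.tile_eq ((hz4 t).trans (hz3 (z t))) (by decide)).symm
  -- Corner 1 of `t` meets corner 4 of `x t` and corner 3 of `y t`, and the latter meets corner 4 of
  -- `z (y t)`. Corner 4 occurs only once at this vertex.
  have hzy : ∀ t, z (y t) = x t := fun t =>
    hk.tile_eq (((hz3 (y t)).symm.trans (hy1 t).symm).trans (hx1 t)) (by decide)
  have hyinj : Function.Injective y := fun t t' h =>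
    hk.tile_eq ((hy1 t).trans (h ▸ (hy1 t').symm)) (by decide)
  let Z : Equiv.Perm A.Tile := ⟨z, z, hzz, hzz⟩
  let Y : Equiv.Perm A.Tile := Equiv.ofBijective y (Finite.injective_iff_bijective.1 hyinj)
  have hYa : ∀ t, Y t = y t := fun _ => rfl
  have hXa : ∀ t, (Z * Y) t = x t := hzy
  have hc0 := hA.sameCycle_iff (f := Z * Y) (k := 0) (a := 0) (b := 4)
    (by simpa only [hXa] using hxne) (by simpa only [hXa] using hxs)
    (fun t => by rw [hXa]; exact (hx0 t).symm)
    (fun t t' i h => by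
      rcases ZMod.five_cases i with rfl | rfl | rfl | rfl | rfl <;>
        first | rfl | exact absurd (hk.kind_eq h) (by decide)) (by decide)
  have hc2 := hA.sameCycle_iff (f := Y) (k := 2) (a := 1) (b := 2)
    (by simpa only [hYa] using hyne) (by simpa only [hYa] using hys)
    (fun t => by rw [hYa]; exact (hy2 t).symm)
    (fun t t' i h => by
      rcases ZMod.five_cases i with rfl | rfl | rfl | rfl | rfl <;>
        first | rfl | exact absurd (hk.kind_eq h) (by decide)) (by decide)
  refine ⟨Y, Z, hk, ?_, pow_ncard_eq_one hc2 h2, pow_ncard_eq_one hc0 h0, hc0, hc2, hy1,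
    fun t => by rw [hXa]; exact hx1 t, ?_⟩
  · ext t; exact hzz t
  -- Two arcs could share both ends without being equal. Here every side has an end of kind 1, where
  -- the neighbouring tile is determined by its corner.
  · intro t t' i j
    refine ⟨hA.endpoints _ _ _ _, fun hends => ?_⟩
    by_cases htt : t = t'
    · subst htt
      have : s(i, i + 1) = s(j, j + 1) := by
        apply Sym2.map.injective (hA.corner_inj t)
        simpa using hends
      congr 1
      clear hends
      revert this
      revert i j
      decide
    have h14 : ∀ {t t'}, A.corner t 1 = A.corner t' 4 → A.side t 0 = A.side t' 4 := by
      intro t t' h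
      rw [← hk.tile_eq ((hx1 t).symm.trans h) (by decide)]
      exact hxs t
    have h13 : ∀ {t t'}, A.corner t 1 = A.corner t' 3 → A.side t 1 = A.side t' 2 := by
      intro t t' h
      rw [← hk.tile_eq ((hy1 t).symm.trans h) (by decide)]
      exact hys t
    have h34 : ∀ {t t'}, A.corner t 3 = A.corner t' 4 → A.side t 3 = A.side t' 3 := by
      intro t t' h
      rw [← hk.tile_eq ((hz3 t).symm.trans h) (by decide)]
      exact hzs t
    rw [Sym2.eq_iff] at hends
    rcases ZMod.five_cases i with rfl | rfl | rfl | rfl | rfl <;>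
    rcases ZMod.five_cases j with rfl | rfl | rfl | rfl | rfl <;>
      simp only [zero_add, e1, e2, e3, e4] at hends <;>
      rcases hends with ⟨h1, h2⟩ | ⟨h1, h2⟩ <;>
      first
        | exact absurd (hk.kind_eq h1) (by decide)
        | exact absurd (hk.kind_eq h2) (by decide)
        | exact absurd (hk.tile_eq h1 (by decide)) htt
        | exact absurd (hk.tile_eq h2 (by decide)) htt
        | exact h14 h2
        | exact h13 h1
        | exact h34 h1
        | exact (h14 h1.symm).symm
        | exact (h13 h2.symm).symm

end AngledComplex

/-! ### Orbits of the triangle groups `(2, 3, 4)` and `(2, 3, 5)` -/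

namespace Equiv.Perm

variable {X : Type*}

/-- The power of a permutation with exponent in `ZMod n`. -/
def zmodPow {n : ℕ} (x : Equiv.Perm X) (i : ZMod n) : Equiv.Perm X := x ^ i.val

lemma zmodPow_add {n : ℕ} [NeZero n] {x : Equiv.Perm X} (hx : x ^ n = 1) (i j : ZMod n) (t : X) :
    x.zmodPow (i + j) t = x.zmodPow i (x.zmodPow j t) := by
  rw [← Equiv.Perm.mul_apply, zmodPow, zmodPow, zmodPow, ← pow_add, ZMod.val_add,
    ← pow_eq_pow_mod _ hx]

lemma zmodPow_zero {n : ℕ} (x : Equiv.Perm X) (t : X) : x.zmodPow (0 : ZMod n) t = t := by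
  simp [zmodPow]

lemma zmodPow_one {n : ℕ} [Fact (1 < n)] (x : Equiv.Perm X) (t : X) :
    x.zmodPow (1 : ZMod n) t = x t := by
  simp [zmodPow, ZMod.val_one]

/-- With `z² = 1`, the relation `(zx)³ = 1` reads `z x z = x⁻¹ z x⁻¹`; this is the rewriting rule
behind both orbit counts. -/
lemma zmodPow_conj {n : ℕ} [NeZero n] [Fact (1 < n)] {x z : Equiv.Perm X} (hz : z * z = 1)
    (hx : x ^ n = 1) (hzx : (z * x) ^ 3 = 1) (t : X) :
    z (x.zmodPow (1 : ZMod n) (z t)) = x.zmodPow (-1 : ZMod n) (z (x.zmodPow (-1 : ZMod n) t)) := by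
  have h1 : ∀ t, x.zmodPow (1 : ZMod n) (x.zmodPow (-1 : ZMod n) t) = t := fun t => by
    rw [← zmodPow_add hx, add_neg_cancel, zmodPow_zero]
  have hzz : ∀ t, z (z t) = t := fun t => congrArg (fun f : Equiv.Perm X => f t) hz
  have h3 : ∀ t, z (x (z (x (z (x t))))) = t := fun t =>
    congrArg (fun f : Equiv.Perm X => f t) (by rw [← hzx, pow_three]; rfl :
      z * (x * (z * (x * (z * x)))) = 1)
  apply (x.zmodPow (1 : ZMod n)).injective
  rw [h1]
  apply z.injective
  rw [hzz]
  have := h3 (x.zmodPow (-1 : ZMod n) t)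
  simpa only [← zmodPow_one (n := n) x, h1] using this

/-- Puts all `f i` into one `x`-orbit; in the orbit counts this closes up the last vertex. -/
lemma eq_zmodPow_neg {n : ℕ} [NeZero n] [Fact (1 < n)] {x : Equiv.Perm X} (hx : x ^ n = 1)
    {f : ZMod n → X} (hf : ∀ i, f (i + 1) = x.zmodPow (-1 : ZMod n) (f i)) (i : ZMod n) :
    f i = x.zmodPow (-i) (f 0) := by
  rw [← ZMod.natCast_zmod_val i]
  induction i.val with
  | zero => simp [zmodPow_zero]
  | succ m ih => rw [Nat.cast_succ, hf, ih, ← zmodPow_add hx]; congr 2; ring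

lemma ncard_range_le {P : Type*} [Fintype P] (F : P → X) :
    (Set.range F).Finite ∧ (Set.range F).ncard ≤ Fintype.card P := by
  refine ⟨Set.finite_range F, ?_⟩
  rw [← Set.image_univ, ← Nat.card_eq_fintype_card, ← Set.ncard_univ]
  exact Set.ncard_image_le

/-- Orbits of the triangle group `(2, 3, 4)` have at most 24 elements. -/
theorem exists_orbit_octahedral {y z : Equiv.Perm X} (hz : z * z = 1) (hy : y ^ 3 = 1)
    (hx : (z * y) ^ 4 = 1) (t : X) :
    ∃ S : Set X, S.Finite ∧ S.ncard ≤ 24 ∧ t ∈ S ∧ (∀ u ∈ S, y u ∈ S) ∧ ∀ u ∈ S, z u ∈ S := by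
  set x := z * y with hxdef
  have hyx : y = z * x := by rw [hxdef, ← mul_assoc, hz, one_mul]
  rw [hyx] at hy
  have : Fact (1 < 4) := ⟨by norm_num⟩
  let R : ZMod 4 → Equiv.Perm X := x.zmodPow
  have hadd : ∀ i j t, R i (R j t) = R (i + j) t := fun i j t => (zmodPow_add hx i j t).symm
  have h0 : ∀ t, R 0 t = t := fun t => zmodPow_zero x t
  have hzz : ∀ t, z (z t) = t := fun t => congrArg (fun f : Equiv.Perm X => f t) hz
  have hrel : ∀ t, z (R 1 (z t)) = R (-1) (z (R (-1) t)) := zmodPow_conj hz hx hy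
  -- With `x` as rotation about a vertex and `z` as passage to the other end of an edge, `R k t`
  -- lies at a base vertex, `R k (U i)` at its four neighbours and `R k (D 0)` at the antipode: 4 +
  -- 16 + 4 = 24.
  let U : ZMod 4 → X := fun i => z (R i t)
  let D : ZMod 4 → X := fun i => z (R 2 (U i))
  have hU1 : ∀ i, z (R 1 (U (i + 1))) = R (-1) (U i) := fun i => by
    simp only [U]; rw [hrel, hadd]; congr 4; ring
  have hU3 : ∀ i, z (R (-1) (U i)) = R 1 (U (i + 1)) := fun i => by rw [← hU1, hzz]
  have hD : ∀ i, D (i + 1) = R (-1) (D i) := fun i => by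
    have : R 2 (U (i + 1)) = R 1 (z (R (-1) (U i))) := by rw [hU3, hadd]; rfl
    simp only [D]
    rw [this, hrel, hadd]
    rfl
  have hD0 := eq_zmodPow_neg hx hD
  let F : ZMod 4 ⊕ (ZMod 4 × ZMod 4) ⊕ ZMod 4 → X :=
    Sum.elim (fun k => R k t) (Sum.elim (fun p => R p.1 (U p.2)) (fun k => R k (D 0)))
  have hFx : ∀ u ∈ range F, x u ∈ range F := by
    rintro _ ⟨p, rfl⟩
    have hx1 : ∀ k u, x (R k u) = R (1 + k) u := fun k u => by
      rw [← hadd]; exact (zmodPow_one x _).symm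
    rcases p with k | ⟨k, i⟩ | k
    · exact ⟨.inl (1 + k), (hx1 _ _).symm⟩
    · exact ⟨.inr (.inl (1 + k, i)), (hx1 _ _).symm⟩
    · exact ⟨.inr (.inr (1 + k)), (hx1 _ _).symm⟩
  have hFz : ∀ u ∈ range F, z u ∈ range F := by
    rintro _ ⟨p, rfl⟩
    rcases p with k | ⟨k, i⟩ | k
    · exact ⟨.inr (.inl (0, k)), h0 _⟩
    · have hk : k = 0 ∨ k = 1 ∨ k = 2 ∨ k = -1 := by revert k; decide
      rcases hk with rfl | rfl | rfl | rfl
      · refine ⟨.inl i, ?_⟩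
        show R i t = z (R 0 (z (R i t)))
        rw [h0, hzz]
      · refine ⟨.inr (.inl (-1, i - 1)), ?_⟩
        have := hU1 (i - 1)
        rw [sub_add_cancel] at this
        exact this.symm
      · exact ⟨.inr (.inr (-i)), (hD0 i).symm⟩
      · exact ⟨.inr (.inl (1, i + 1)), (hU3 i).symm⟩
    · refine ⟨.inr (.inl (2, -k)), ?_⟩
      have : R k (D 0) = D (-k) := by rw [hD0 (-k), neg_neg]
      show R 2 (U (-k)) = z (R k (D 0))
      rw [this, hzz]
  refine ⟨range F, (ncard_range_le F).1, (ncard_range_le F).2.trans (by simp [ZMod.card]),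
    ⟨.inl 0, h0 t⟩, fun u hu => ?_, hFz⟩
  rw [hyx]
  exact hFz _ (hFx u hu)

/-- Orbits of the triangle group `(2, 3, 5)` have at most 60 elements. -/
theorem exists_orbit_icosahedral {y z : Equiv.Perm X} (hz : z * z = 1) (hy : y ^ 3 = 1)
    (hx : (z * y) ^ 5 = 1) (t : X) :
    ∃ S : Set X, S.Finite ∧ S.ncard ≤ 60 ∧ t ∈ S ∧ (∀ u ∈ S, y u ∈ S) ∧ ∀ u ∈ S, z u ∈ S := by
  set x := z * y with hxdef
  have hyx : y = z * x := by rw [hxdef, ← mul_assoc, hz, one_mul]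
  rw [hyx] at hy
  have : Fact (1 < 5) := ⟨by norm_num⟩
  let R : ZMod 5 → Equiv.Perm X := x.zmodPow
  have hadd : ∀ i j t, R i (R j t) = R (i + j) t := fun i j t => (zmodPow_add hx i j t).symm
  have h0 : ∀ t, R 0 t = t := fun t => zmodPow_zero x t
  have hzz : ∀ t, z (z t) = t := fun t => congrArg (fun f : Equiv.Perm X => f t) hz
  have hrel : ∀ t, z (R 1 (z t)) = R (-1) (z (R (-1) t)) := zmodPow_conj hz hx hy
  -- A base vertex, its five neighbours (`U`), the five vertices at distance two (`D`) and the
  -- antipode (`E`): 5 + 25 + 25 + 5 = 60.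
  let U : ZMod 5 → X := fun i => z (R i t)
  let D : ZMod 5 → X := fun i => z (R 2 (U i))
  let E : ZMod 5 → X := fun i => z (R 3 (D i))
  have hU1 : ∀ i, z (R 1 (U (i + 1))) = R (-1) (U i) := fun i => by
    simp only [U]; rw [hrel, hadd]; congr 4; ring
  have hU4 : ∀ i, z (R (-1) (U i)) = R 1 (U (i + 1)) := fun i => by rw [← hU1, hzz]
  -- Direction 3 at neighbour `i` and direction 2 at neighbour `i + 1` lead to the same vertex, so
  -- five vertices suffice in the second ring.
  have hU3 : ∀ i, z (R 3 (U i)) = R 1 (D (i + 1)) := fun i => by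
    have : R 2 (U (i + 1)) = R 1 (z (R (-1) (U i))) := by rw [hU4, hadd]; rfl
    simp only [D]
    rw [this, hrel, hadd, hadd, add_neg_cancel, h0]
    rfl
  have hD1 : ∀ i, z (R 1 (D (i + 1))) = R 3 (U i) := fun i => by rw [← hU3, hzz]
  have hD2 : ∀ i, z (R 2 (D (i + 1))) = R (-1) (D i) := fun i => by
    have : R 2 (D (i + 1)) = R 1 (z (R 3 (U i))) := by rw [hU3, hadd]; rfl
    rw [this, hrel, hadd]
    rfl
  have hD4 : ∀ i, z (R (-1) (D i)) = R 2 (D (i + 1)) := fun i => by rw [← hD2, hzz]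
  have hE : ∀ i, E (i + 1) = R (-1) (E i) := fun i => by
    have : R 3 (D (i + 1)) = R 1 (z (R (-1) (D i))) := by rw [hD4, hadd]; rfl
    simp only [E]
    rw [this, hrel, hadd]
    rfl
  have hE0 := eq_zmodPow_neg hx hE
  let F : ZMod 5 ⊕ (ZMod 5 × ZMod 5) ⊕ (ZMod 5 × ZMod 5) ⊕ ZMod 5 → X :=
    Sum.elim (fun k => R k t) (Sum.elim (fun p => R p.1 (U p.2))
      (Sum.elim (fun p => R p.1 (D p.2)) (fun k => R k (E 0))))
  have hFx : ∀ u ∈ range F, x u ∈ range F := by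
    rintro _ ⟨p, rfl⟩
    have hx1 : ∀ k u, x (R k u) = R (1 + k) u := fun k u => by
      rw [← hadd]; exact (zmodPow_one x _).symm
    rcases p with k | ⟨k, i⟩ | ⟨k, i⟩ | k
    · exact ⟨.inl (1 + k), (hx1 _ _).symm⟩
    · exact ⟨.inr (.inl (1 + k, i)), (hx1 _ _).symm⟩
    · exact ⟨.inr (.inr (.inl (1 + k, i))), (hx1 _ _).symm⟩
    · exact ⟨.inr (.inr (.inr (1 + k))), (hx1 _ _).symm⟩
  have hcases : ∀ k : ZMod 5, k = 0 ∨ k = 1 ∨ k = 2 ∨ k = 3 ∨ k = -1 := by decide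
  have hFz : ∀ u ∈ range F, z u ∈ range F := by
    rintro _ ⟨p, rfl⟩
    rcases p with k | ⟨k, i⟩ | ⟨k, i⟩ | k
    · exact ⟨.inr (.inl (0, k)), h0 _⟩
    · rcases hcases k with rfl | rfl | rfl | rfl | rfl
      · refine ⟨.inl i, ?_⟩
        show R i t = z (R 0 (z (R i t)))
        rw [h0, hzz]
      · refine ⟨.inr (.inl (-1, i - 1)), ?_⟩
        have := hU1 (i - 1)
        rw [sub_add_cancel] at this
        exact this.symm
      · exact ⟨.inr (.inr (.inl (0, i))), h0 _⟩
      · exact ⟨.inr (.inr (.inl (1, i + 1))), (hU3 i).symm⟩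
      · exact ⟨.inr (.inl (1, i + 1)), (hU4 i).symm⟩
    · rcases hcases k with rfl | rfl | rfl | rfl | rfl
      · refine ⟨.inr (.inl (2, i)), ?_⟩
        show R 2 (U i) = z (R 0 (z (R 2 (U i))))
        rw [h0, hzz]
      · refine ⟨.inr (.inl (3, i - 1)), ?_⟩
        have := hD1 (i - 1)
        rw [sub_add_cancel] at this
        exact this.symm
      · refine ⟨.inr (.inr (.inl (-1, i - 1))), ?_⟩
        have := hD2 (i - 1)
        rw [sub_add_cancel] at this
        exact this.symm
      · exact ⟨.inr (.inr (.inr (-i))), (hE0 i).symm⟩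
      · exact ⟨.inr (.inr (.inl (2, i + 1))), (hD4 i).symm⟩
    · refine ⟨.inr (.inr (.inl (3, -k))), ?_⟩
      have : R k (E 0) = E (-k) := by rw [hE0 (-k), neg_neg]
      show R 3 (D (-k)) = z (R k (E 0))
      rw [this, hzz]
  refine ⟨range F, (ncard_range_le F).1, (ncard_range_le F).2.trans (by simp [ZMod.card]),
    ⟨.inl 0, h0 t⟩, fun u hu => ?_, hFz⟩
  rw [hyx]
  exact hFz _ (hFx u hu)

/-- A small invariant set in the product of two transitive actions is the graph of an
isomorphism. -/
lemma exists_equivariant_equiv {Y : Type*} [Finite X] [Finite Y] {y z : Equiv.Perm X}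
    {y' z' : Equiv.Perm Y}
    (hX : ∀ S : Set X, S.Nonempty → (∀ t ∈ S, y t ∈ S) → (∀ t ∈ S, z t ∈ S) → ∀ t, t ∈ S)
    (hY : ∀ S : Set Y, S.Nonempty → (∀ t ∈ S, y' t ∈ S) → (∀ t ∈ S, z' t ∈ S) → ∀ t, t ∈ S)
    (S : Set (X × Y)) (hS : S.Nonempty) (hcX : S.ncard ≤ Nat.card X) (hcY : S.ncard ≤ Nat.card Y)
    (hy : ∀ u ∈ S, (y u.1, y' u.2) ∈ S) (hz : ∀ u ∈ S, (z u.1, z' u.2) ∈ S) :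
    ∃ e : X ≃ Y, (∀ t, e (y t) = y' (e t)) ∧ ∀ t, e (z t) = z' (e t) := by
  -- The projection of `S` is invariant, hence everything by transitivity; the bound on the size of
  -- `S` makes the projection bijective.
  have hbij : Function.Bijective (fun u : S => u.1.1) := by
    rw [Nat.bijective_iff_surjective_and_card]
    have hs : Function.Surjective (fun u : S => u.1.1) := by
      intro t
      refine hX (range fun u : S => u.1.1) ?_ ?_ ?_ t
      · obtain ⟨u, hu⟩ := hS
        exact ⟨_, ⟨u, hu⟩, rfl⟩
      · rintro _ ⟨⟨u, hu⟩, rfl⟩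
        exact ⟨⟨_, hy u hu⟩, rfl⟩
      · rintro _ ⟨⟨u, hu⟩, rfl⟩
        exact ⟨⟨_, hz u hu⟩, rfl⟩
    exact ⟨hs, le_antisymm hcX (Nat.card_le_card_of_surjective _ hs)⟩
  have hbij' : Function.Bijective (fun u : S => u.1.2) := by
    rw [Nat.bijective_iff_surjective_and_card]
    have hs : Function.Surjective (fun u : S => u.1.2) := by
      intro t
      refine hY (range fun u : S => u.1.2) ?_ ?_ ?_ t
      · obtain ⟨u, hu⟩ := hS
        exact ⟨_, ⟨u, hu⟩, rfl⟩
      · rintro _ ⟨⟨u, hu⟩, rfl⟩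
        exact ⟨⟨_, hy u hu⟩, rfl⟩
      · rintro _ ⟨⟨u, hu⟩, rfl⟩
        exact ⟨⟨_, hz u hu⟩, rfl⟩
    exact ⟨hs, le_antisymm hcY (Nat.card_le_card_of_surjective _ hs)⟩
  let e₁ := Equiv.ofBijective _ hbij
  let e₂ := Equiv.ofBijective _ hbij'
  have key : ∀ u (hu : u ∈ S), (e₁.symm.trans e₂) u.1 = u.2 := by
    intro u hu
    have : e₁.symm u.1 = ⟨u, hu⟩ := by
      rw [Equiv.symm_apply_eq]
      rfl
    rw [Equiv.trans_apply, this]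
    rfl
  refine ⟨e₁.symm.trans e₂, fun t => ?_, fun t => ?_⟩
  · obtain ⟨⟨u, hu⟩, rfl⟩ := hbij.2 t
    rw [key u hu]
    exact key _ (hy u hu)
  · obtain ⟨⟨u, hu⟩, rfl⟩ := hbij.2 t
    rw [key u hu]
    exact key _ (hz u hu)

end Equiv.Perm

/-! ### Symmetries of the pentagon and reindexing of tiles -/

namespace PentagonSymm

/-- The inverse symmetry. -/
def inv (g : PentagonSymm) : PentagonSymm := ⟨g.reflect, if g.reflect then g.shift else -g.shift⟩

lemma inv_onCorner (g : PentagonSymm) (i : ZMod 5) : g.inv.onCorner (g.onCorner i) = i := by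
  rcases g with ⟨_ | _, s⟩ <;> simp [inv, onCorner]

lemma onCorner_inv (g : PentagonSymm) (i : ZMod 5) : g.onCorner (g.inv.onCorner i) = i := by
  rcases g with ⟨_ | _, s⟩ <;> simp [inv, onCorner]

lemma onSide_inv (g : PentagonSymm) (i : ZMod 5) : g.onSide (g.inv.onSide i) = i := by
  rcases g with ⟨_ | _, s⟩
  · simp [inv, onSide]
  · simp only [inv, onSide, if_true]
    ring

lemma onCorner_injective (g : PentagonSymm) : Function.Injective g.onCorner :=
  Function.LeftInverse.injective g.inv_onCorner

/-- The symmetry as a permutation of the corners. -/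
def cornerEquiv (g : PentagonSymm) : ZMod 5 ≃ ZMod 5 :=
  ⟨g.onCorner, g.inv.onCorner, g.inv_onCorner, g.onCorner_inv⟩

lemma endpoints (g : PentagonSymm) (i : ZMod 5) :
    s(g.onCorner i, g.onCorner (i + 1)) = s(g.onSide i, g.onSide i + 1) := by
  rcases g with ⟨_ | _, s⟩
  · simp [onCorner, onSide, add_right_comm]
  · rw [Sym2.eq_swap]
    simp only [onCorner, onSide, if_true]
    rw [sub_add_cancel, sub_add_eq_sub_sub]

/-- Composition of symmetries. -/
lemma exists_comp (g h : PentagonSymm) : ∃ k : PentagonSymm, ∀ i,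
    k.onCorner i = g.onCorner (h.onCorner i) := by
  rcases g with ⟨_ | _, s⟩ <;> rcases h with ⟨_ | _, r⟩
  · exact ⟨⟨false, r + s⟩, fun i => by simp [onCorner, add_assoc]⟩
  · exact ⟨⟨true, r + s⟩, fun i => by simp [onCorner]; ring⟩
  · exact ⟨⟨true, s - r⟩, fun i => by simp [onCorner]; ring⟩
  · exact ⟨⟨false, s - r⟩, fun i => by simp [onCorner]; ring⟩

end PentagonSymm

namespace AngledComplex

/-- The same complex, with the corners of each tile numbered differently. -/
def reindex (A : AngledComplex) (g : A.Tile → PentagonSymm) : AngledComplex where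
  Tile := A.Tile
  Vertex := A.Vertex
  Edge := A.Edge
  corner t i := A.corner t ((g t).onCorner i)
  side t i := A.side t ((g t).onSide i)
  angle t i := A.angle t ((g t).onCorner i)

lemma map_endpoints (A : AngledComplex) (t : A.Tile) (g : PentagonSymm) (i : ZMod 5) :
    s(A.corner t (g.onCorner i), A.corner t (g.onCorner (i + 1))) =
      s(A.corner t (g.onSide i), A.corner t (g.onSide i + 1)) := by
  simpa using congrArg (Sym2.map (A.corner t)) (g.endpoints i)

/-- Renumbering may reflect some tiles and not others: `IsGlued` presupposes no orientation. -/
lemma IsGlued.reindex {A : AngledComplex} (hA : A.IsGlued) (g : A.Tile → PentagonSymm) :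
    (A.reindex g).IsGlued where
  corner_inj t := (hA.corner_inj t).comp (g t).onCorner_injective
  exists_glue t i := by
    obtain ⟨t', j, hne, h⟩ := hA.exists_glue t ((g t).onSide i)
    refine ⟨t', (g t').inv.onSide j, hne, ?_⟩
    show A.side _ _ = A.side _ _
    rw [(g t').onSide_inv, h]
  glue_unique t i t₁ t₂ j₁ j₂ h₁ h₂ hs₁ hs₂ := hA.glue_unique t _ t₁ t₂ _ _ h₁ h₂ hs₁ hs₂
  endpoints t i t' j h := (A.map_endpoints t (g t) i).trans
    ((hA.endpoints _ _ _ _ h).trans (A.map_endpoints t' (g t') j).symm)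
  link p S := by
    rintro ⟨t, ht, i, hi⟩ hcl t' i' hp
    refine hA.link p S ⟨t, ht, _, hi⟩ ?_ t' _ hp
    intro u hu k u' j hk hs
    refine hcl u hu ((g u).inv.onSide k) u' ((g u').inv.onSide j) ?_ ?_
    · have h1 : (p : A.Vertex) ∈ s(A.corner u k, A.corner u (k + 1)) :=
        Sym2.mem_iff.2 (hk.imp Eq.symm Eq.symm)
      rw [← (g u).onSide_inv k, ← map_endpoints] at h1
      exact (Sym2.mem_iff.1 h1).imp Eq.symm Eq.symm
    · show A.side _ _ = A.side _ _
      rwa [(g u).onSide_inv, (g u').onSide_inv]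
  connected S hS hcl := hA.connected S hS fun t ht t' i j h =>
    hcl t ht t' ((g t).inv.onCorner i) ((g t').inv.onCorner j) (by
      show A.corner _ _ = A.corner _ _
      rwa [(g t).onCorner_inv, (g t').onCorner_inv])

/-! ### Subdivisions with the same permutations are isomorphic -/

namespace IsSubdivision

variable {A B : AngledComplex} {n : ℕ} {y z : Equiv.Perm A.Tile} {y' z' : Equiv.Perm B.Tile}

/-- Every corner among 1, 3, 4 of a tile is corner 1 of another. -/
def rotation (y z : Equiv.Perm A.Tile) (i : ZMod 5) : Equiv.Perm A.Tile :=
  if i = 3 then y⁻¹ else if i = 4 then (z * y)⁻¹ else 1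

lemma corner_eq_rotation (hA : A.IsSubdivision n y z) (t : A.Tile) {i : ZMod 5}
    (hi : i = 1 ∨ i = 3 ∨ i = 4) : A.corner t i = A.corner (rotation y z i t) 1 := by
  rcases hi with rfl | rfl | rfl
  · rfl
  · rw [hA.corner_one_three]
    show _ = A.corner (y (y⁻¹ t)) 3
    simp
  · rw [hA.corner_one_four]
    show _ = A.corner ((z * y) ((z * y)⁻¹ t)) 4
    rw [← Equiv.Perm.mul_apply, mul_inv_cancel, Equiv.Perm.one_apply]

/-- The right side involves only `y` and `z`; hence an equivariant bijection of tiles respects all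
identifications of corners. -/
lemma corner_eq_iff (hA : A.IsSubdivision n y z) (t t' : A.Tile) (i j : ZMod 5) :
    A.corner t i = A.corner t' j ↔ (i = 0 ∧ j = 0 ∧ (z * y).SameCycle t t') ∨
      (i = 2 ∧ j = 2 ∧ y.SameCycle t t') ∨
      ((i = 1 ∨ i = 3 ∨ i = 4) ∧ (j = 1 ∨ j = 3 ∨ j = 4) ∧
        rotation y z i t = rotation y z j t') := by
  constructor
  · intro h
    by_cases hi : i = 1 ∨ i = 3 ∨ i = 4
    · by_cases hj : j = 1 ∨ j = 3 ∨ j = 4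
      · refine Or.inr (Or.inr ⟨hi, hj, ?_⟩)
        rw [hA.corner_eq_rotation t hi, hA.corner_eq_rotation t' hj] at h
        exact hA.kinds.tile_eq h rfl
      · have hk := hA.kinds.kind_eq h
        rcases hi with rfl | rfl | rfl <;>
          rcases ZMod.five_cases j with rfl | rfl | rfl | rfl | rfl <;>
          first | exact absurd hk (by decide) | exact absurd (by decide) hj
    · have hk := hA.kinds.kind_eq h
      rcases ZMod.five_cases i with rfl | rfl | rfl | rfl | rfl <;>
        first
        | exact absurd (by decide) hi
        | rcases ZMod.five_cases j with rfl | rfl | rfl | rfl | rfl <;>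
          first
          | exact absurd hk (by decide)
          | exact Or.inl ⟨rfl, rfl, (hA.corner_zero _ _).1 h⟩
          | exact Or.inr (Or.inl ⟨rfl, rfl, (hA.corner_two _ _).1 h⟩)
  · rintro (⟨rfl, rfl, h⟩ | ⟨rfl, rfl, h⟩ | ⟨hi, hj, h⟩)
    · exact (hA.corner_zero _ _).2 h
    · exact (hA.corner_two _ _).2 h
    · rw [hA.corner_eq_rotation t hi, hA.corner_eq_rotation t' hj, h]

lemma corner_eq_iff_of_equiv (hA : A.IsSubdivision n y z) (hB : B.IsSubdivision n y' z')
    (e : A.Tile ≃ B.Tile) (hy : ∀ t, e (y t) = y' (e t)) (hz : ∀ t, e (z t) = z' (e t))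
    (t t' : A.Tile) (i j : ZMod 5) :
    A.corner t i = A.corner t' j ↔ B.corner (e t) i = B.corner (e t') j := by
  have hy' : y' = e.permCongr y := by ext t; simp [hy]
  have hz' : z' = e.permCongr z := by ext t; simp [hz]
  have hmul : ∀ f g : Equiv.Perm A.Tile, e.permCongr f * e.permCongr g = e.permCongr (f * g) :=
    fun f g => by ext t; simp
  have hinv : ∀ f : Equiv.Perm A.Tile, (e.permCongr f)⁻¹ = e.permCongr f⁻¹ := fun f => by
    rw [inv_eq_iff_mul_eq_one, hmul, mul_inv_cancel]; ext t; simp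
  have hcyc : ∀ (f : Equiv.Perm A.Tile) (t t'), (e.permCongr f).SameCycle (e t) (e t') ↔
      f.SameCycle t t' := by
    intro f t t'
    have hpow : ∀ k : ℤ, (e.permCongr f) ^ k = e.permCongr (f ^ k) := fun k =>
      (map_zpow (e.permCongrHom : Equiv.Perm A.Tile →* Equiv.Perm B.Tile) f k).symm
    simp [Equiv.Perm.SameCycle, hpow]
  have hrot : ∀ i (t : A.Tile), rotation y' z' i (e t) = e (rotation y z i t) := by
    intro i t
    rw [hy', hz', rotation, rotation, hmul, hinv, hinv]
    split_ifs <;> simp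
  rw [hA.corner_eq_iff, hB.corner_eq_iff, hrot, hrot, e.apply_eq_iff_eq, hy', hz', hmul, hcyc, hcyc]

lemma side_eq_iff_of_equiv (hA : A.IsSubdivision n y z) (hB : B.IsSubdivision n y' z')
    (e : A.Tile ≃ B.Tile) (hy : ∀ t, e (y t) = y' (e t)) (hz : ∀ t, e (z t) = z' (e t))
    (t t' : A.Tile) (i j : ZMod 5) :
    A.side t i = A.side t' j ↔ B.side (e t) i = B.side (e t') j := by
  rw [hA.side_eq_iff, hB.side_eq_iff, Sym2.eq_iff, Sym2.eq_iff]
  simp only [hA.corner_eq_iff_of_equiv hB e hy hz]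

/-- Tiles of a glued complex are connected by the two permutations. -/
lemma transitive [Finite A.Tile] (hA : A.IsSubdivision n y z) (hG : A.IsGlued) (S : Set A.Tile)
    (hS : S.Nonempty) (hy : ∀ t ∈ S, y t ∈ S) (hz : ∀ t ∈ S, z t ∈ S) (t : A.Tile) : t ∈ S := by
  have hy' : ∀ t, (y t ∈ S) = (t ∈ S) := fun t => propext ⟨fun h => by
    have h3 : y (y (y t)) = t := congrArg (fun f : Equiv.Perm A.Tile => f t)
      ((pow_three y).symm.trans hA.y_pow)
    rw [← h3]
    exact hy _ (hy _ h), hy t⟩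
  have hz' : ∀ t, (z t ∈ S) = (t ∈ S) := fun t => propext ⟨fun h => by
    have h2 : z (z t) = t := congrArg (fun f : Equiv.Perm A.Tile => f t) hA.z_mul_z
    rw [← h2]
    exact hz _ h, hz t⟩
  have hzy : ∀ t, ((z * y) t ∈ S) = (t ∈ S) := fun t => (hz' _).trans (hy' t)
  have hrot : ∀ i t, (rotation y z i t ∈ S) = (t ∈ S) := by
    intro i t
    rw [rotation]
    split_ifs
    · rw [← hy' (y⁻¹ t)]; simp
    · rw [← hzy, ← Equiv.Perm.mul_apply, mul_inv_cancel, Equiv.Perm.one_apply]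
    · simp
  refine hG.connected S hS ?_ t
  intro t ht t' i j h
  rcases (hA.corner_eq_iff _ _ _ _).1 h with ⟨-, -, h⟩ | ⟨-, -, h⟩ | ⟨-, -, h⟩
  · exact (h.apply_eq_of_invariant (g := (· ∈ S)) hzy) ▸ ht
  · exact (h.apply_eq_of_invariant (g := (· ∈ S)) hy') ▸ ht
  · rw [← hrot i, h, hrot] at ht
    exact ht

end IsSubdivision

/-- Two subdivisions of the same size are isomorphic if the orbits of the group generated by `y`
and `z` cannot be larger. -/
theorem exists_equiv_of_isSubdivision {A B : AngledComplex} [Finite A.Tile] [Finite B.Tile]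
    {n N : ℕ} {y z : Equiv.Perm A.Tile} {y' z' : Equiv.Perm B.Tile}
    (hA : A.IsSubdivision n y z) (hG : A.IsGlued) (hB : B.IsSubdivision n y' z')
    (hBt : ∀ S : Set B.Tile, S.Nonempty → (∀ t ∈ S, y' t ∈ S) → (∀ t ∈ S, z' t ∈ S) → ∀ t, t ∈ S)
    (hbound : ∀ (y z : Equiv.Perm (A.Tile × B.Tile)), z * z = 1 → y ^ 3 = 1 → (z * y) ^ n = 1 →
      ∀ t, ∃ S : Set (A.Tile × B.Tile), S.Finite ∧ S.ncard ≤ N ∧ t ∈ S ∧ (∀ u ∈ S, y u ∈ S) ∧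
        ∀ u ∈ S, z u ∈ S)
    (hcA : Nat.card A.Tile = N) (hcB : Nat.card B.Tile = N) (hN : N ≠ 0) :
    ∃ e : A.Tile ≃ B.Tile,
      (∀ t t' i j, A.corner t i = A.corner t' j ↔ B.corner (e t) i = B.corner (e t') j) ∧
      ∀ t t' i j, A.side t i = A.side t' j ↔ B.side (e t) i = B.side (e t') j := by
  have hmul : ∀ (f h : Equiv.Perm A.Tile) (f' h' : Equiv.Perm B.Tile),
      (Equiv.prodCongr f f' : Equiv.Perm (A.Tile × B.Tile)) * Equiv.prodCongr h h' =
        Equiv.prodCongr (f * h) (f' * h') := fun f h f' h' => by ext t <;> simp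
  have hone : (Equiv.prodCongr (1 : Equiv.Perm A.Tile) (1 : Equiv.Perm B.Tile) :
      Equiv.Perm (A.Tile × B.Tile)) = 1 := by ext t <;> simp
  have hpow : ∀ (f : Equiv.Perm A.Tile) (f' : Equiv.Perm B.Tile) (k : ℕ),
      (Equiv.prodCongr f f' : Equiv.Perm (A.Tile × B.Tile)) ^ k =
        Equiv.prodCongr (f ^ k) (f' ^ k) := by
    intro f f' k
    induction k with
    | zero => exact hone.symm
    | succ k ih => rw [pow_succ, ih, hmul, pow_succ, pow_succ]
  have hnA : Nonempty A.Tile := (Nat.card_pos_iff.1 (by omega)).1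
  have hnB : Nonempty B.Tile := (Nat.card_pos_iff.1 (by omega)).1
  -- The diagonal action on pairs satisfies the same relations, so the orbit bound applies to it.
  obtain ⟨S, -, hcard, hmem, hSy, hSz⟩ := hbound (Equiv.prodCongr y y') (Equiv.prodCongr z z')
    (by rw [hmul, hA.z_mul_z, hB.z_mul_z, hone])
    (by rw [hpow, hA.y_pow, hB.y_pow, hone])
    (by rw [hmul, hpow, hA.zy_pow, hB.zy_pow, hone])
    (Classical.arbitrary A.Tile, Classical.arbitrary B.Tile)
  obtain ⟨e, hey, hez⟩ := Equiv.Perm.exists_equivariant_equiv (hA.transitive hG) hBt S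
    ⟨_, hmem⟩ (hcard.trans hcA.ge) (hcard.trans hcB.ge) hSy hSz
  exact ⟨e, hA.corner_eq_iff_of_equiv hB e hey hez, hA.side_eq_iff_of_equiv hB e hey hez⟩

/-- Here `g` leads from the normalised numbering to the original one, so the matching in
`Isomorphic` is its inverse. -/
lemma isomorphic_of_reindex {A B : AngledComplex} (g : A.Tile → PentagonSymm)
    (e : A.Tile ≃ B.Tile) (hangle : ∀ t i, A.angle t ((g t).onCorner i) = B.angle (e t) i)
    (hcorner : ∀ t t' i j, (A.reindex g).corner t i = (A.reindex g).corner t' j ↔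
      B.corner (e t) i = B.corner (e t') j)
    (hside : ∀ t t' i j, (A.reindex g).side t i = (A.reindex g).side t' j ↔
      B.side (e t) i = B.side (e t') j) : A.Isomorphic B := by
  refine ⟨e, fun t => (g t).inv, fun t i => ?_, fun t t' i j => ?_, fun t t' i j => ?_⟩
  · rw [← hangle t, (g t).onCorner_inv]
  · refine Iff.trans (Eq.to_iff ?_) (hcorner t t' _ _)
    show _ = (A.corner _ _ = A.corner _ _)
    rw [(g t).onCorner_inv, (g t').onCorner_inv]
  · refine Iff.trans (Eq.to_iff ?_) (hside t t' _ _)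
    show _ = (A.side _ _ = A.side _ _)
    rw [(g t).onSide_inv, (g t').onSide_inv]

end AngledComplex

/-! ### The pentagonal subdivisions of the octahedron and the icosahedron -/

namespace TriangularPolyhedron

variable {P : TriangularPolyhedron}

/-- The tile at the next vertex of the same face. -/
def nextTile (P : TriangularPolyhedron) : Equiv.Perm (P.Face × ZMod 3) :=
  Equiv.prodCongr (Equiv.refl _) (Equiv.addRight 1)

lemma nextTile_pow (k : ℕ) (t : P.Face × ZMod 3) : (P.nextTile ^ k) t = (t.1, t.2 + k) := by
  induction k with
  | zero => simp
  | succ k ih =>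
    rw [pow_succ', Equiv.Perm.mul_apply, ih]
    simp [nextTile, add_assoc]

lemma nextTile_pow_three : P.nextTile ^ 3 = 1 := by
  ext1 t
  rw [nextTile_pow]
  exact Prod.ext rfl (add_eq_left.2 rfl)

lemma sameCycle_nextTile_iff (t t' : P.Face × ZMod 3) :
    P.nextTile.SameCycle t t' ↔ t.1 = t'.1 := by
  constructor
  · intro h
    exact h.apply_eq_of_invariant (g := fun t : P.Face × ZMod 3 => t.1) fun t => rfl
  · intro h
    refine ⟨((t'.2 - t.2).val : ℕ), ?_⟩
    rw [zpow_natCast, nextTile_pow, h]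
    simp

/-- A triangulated polyhedron with the same number of faces at each vertex: `opp` sends the side
that ends at a corner of a face to the other side along the same edge, and `rep` chooses a corner
at each vertex. -/
structure IsRegular (P : TriangularPolyhedron) (n : ℕ) (opp : Equiv.Perm (P.Face × ZMod 3))
    (rep : P.Vertex → P.Face × ZMod 3) : Prop where
  opp_opp : ∀ f j, opp (opp (f, j)) = (f, j)
  vert_opp : ∀ f j, P.vert (opp (f, j)).1 (opp (f, j)).2 = P.vert f (j - 1)
  vert_opp_pred : ∀ f j, P.vert (opp (f, j)).1 ((opp (f, j)).2 - 1) = P.vert f j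
  exists_rep : ∀ f j, ∃ k : Fin n, (fun t => opp (t.1, t.2 + 1))^[k] (rep (P.vert f j)) = (f, j)
  iterate_eq : ∀ f j, (fun t => opp (t.1, t.2 + 1))^[n] (f, j) = (f, j)
  iterate_free : ∀ f j (k : Fin n), (k : ℕ) ≠ 0 → ∀ t, (fun t => opp (t.1, t.2 + 1))^[k] (f, j) = t →
    P.vert t.1 (t.2 + 1) ≠ P.vert f (j + 1)

namespace IsRegular

variable {n : ℕ} {opp : Equiv.Perm (P.Face × ZMod 3)} {rep : P.Vertex → P.Face × ZMod 3}

/-- `opp * nextTile` turns about an old vertex: step to the next corner, then cross the edge just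
traversed. `IsRegular` states it by iterates of an explicit map, which `decide` can evaluate; group
arguments need powers. -/
lemma iterate_eq_pow (k : ℕ) (t : P.Face × ZMod 3) :
    (fun t => opp (t.1, t.2 + 1))^[k] t = ((opp * P.nextTile) ^ k) t := by
  rw [Equiv.Perm.iterate_eq_pow (opp * P.nextTile) k |>.symm]
  rfl

lemma pow_eq_one (hP : P.IsRegular n opp rep) : (opp * P.nextTile) ^ n = 1 :=
  Equiv.ext fun t => (iterate_eq_pow n t).symm.trans (hP.iterate_eq t.1 t.2)

lemma vert_eq_iff (hP : P.IsRegular n opp rep) (t t' : P.Face × ZMod 3) :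
    P.vert t.1 t.2 = P.vert t'.1 t'.2 ↔ (opp * P.nextTile).SameCycle t t' := by
  constructor
  · intro h
    obtain ⟨k, hk⟩ := hP.exists_rep t.1 t.2
    obtain ⟨l, hl⟩ := hP.exists_rep t'.1 t'.2
    rw [iterate_eq_pow] at hk hl
    rw [h] at hk
    have h1 : (opp * P.nextTile).SameCycle (rep (P.vert t'.1 t'.2)) t := ⟨(k : ℕ), by simpa using hk⟩
    have h2 : (opp * P.nextTile).SameCycle (rep (P.vert t'.1 t'.2)) t' :=
      ⟨(l : ℕ), by simpa using hl⟩
    exact h1.symm.trans h2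
  · intro h
    refine h.apply_eq_of_invariant (g := fun t : P.Face × ZMod 3 => P.vert t.1 t.2) fun t => ?_
    have := hP.vert_opp t.1 (t.2 + 1)
    rwa [add_sub_cancel_right] at this

lemma pow_apply_rep (hP : P.IsRegular n opp rep) (t : P.Face × ZMod 3) {t' : P.Face × ZMod 3}
    (h : P.vert t.1 t.2 = P.vert t'.1 t'.2) :
    ∃ k : Fin n, ((opp * P.nextTile) ^ (k : ℕ)) t = t' := by
  obtain ⟨m, hm⟩ := (hP.vert_eq_iff t t').1 h
  obtain ⟨k₀, -⟩ := hP.exists_rep t.1 t.2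
  have hpos : (n : ℤ) ≠ 0 := by have := k₀.2; omega
  have h0 := Int.emod_nonneg m hpos
  have h1 := Int.emod_lt_of_pos m (by omega : (0 : ℤ) < n)
  refine ⟨⟨(m % n).toNat, by omega⟩, ?_⟩
  rw [← hm, ← zpow_natCast]
  simp only [Int.toNat_of_nonneg h0]
  rw [← Int.emod_add_mul_ediv m n, zpow_add, zpow_mul, zpow_natCast (opp * P.nextTile) n, hP.pow_eq_one]
  simp

/-- Less than a full turn about a vertex changes the far end of the outgoing edge, so an oriented
edge determines its face. This gives `tile_eq` at the vertices `third v w`. -/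
lemma dart_injective (hP : P.IsRegular n opp rep) {t t' : P.Face × ZMod 3}
    (h : P.vert t.1 t.2 = P.vert t'.1 t'.2) (h' : P.vert t.1 (t.2 + 1) = P.vert t'.1 (t'.2 + 1)) :
    t = t' := by
  obtain ⟨k, rfl⟩ := hP.pow_apply_rep t h
  by_contra hne
  have hk : (k : ℕ) ≠ 0 := by
    intro hk
    simp [hk] at hne
  exact hP.iterate_free t.1 t.2 k hk _ (iterate_eq_pow _ _) h'.symm

/-- The number of faces at each vertex is `n`. -/
lemma ncard_vert_eq (hP : P.IsRegular n opp rep) (t : P.Face × ZMod 3) :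
    {t' : P.Face × ZMod 3 | P.vert t'.1 t'.2 = P.vert t.1 t.2}.ncard = n := by
  have hinj : Function.Injective fun k : Fin n => ((opp * P.nextTile) ^ (k : ℕ)) t := by
    have key : ∀ k l : Fin n, k ≤ l → ((opp * P.nextTile) ^ (k : ℕ)) t =
        ((opp * P.nextTile) ^ (l : ℕ)) t → k = l := by
      intro k l hkl h
      by_contra hne
      have h1 : ((opp * P.nextTile) ^ (l - k : ℕ)) t = t := by
        apply ((opp * P.nextTile) ^ (k : ℕ)).injective
        rw [← Equiv.Perm.mul_apply, ← pow_add, h]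
        congr 2
        have : (k : ℕ) ≤ l := hkl
        omega
      have hlt : (l - k : ℕ) < n := by omega
      have hk0 : (l - k : ℕ) ≠ 0 := by
        have h2 : (k : ℕ) ≤ l := hkl
        have h3 : (k : ℕ) ≠ l := fun h => hne (Fin.ext h)
        omega
      exact hP.iterate_free t.1 t.2 ⟨l - k, hlt⟩ hk0 t
        ((iterate_eq_pow _ _).trans h1) rfl
    intro k l h
    rcases le_total k l with hkl | hkl
    · exact key k l hkl h
    · exact (key l k hkl h.symm).symm
  have : {t' : P.Face × ZMod 3 | P.vert t'.1 t'.2 = P.vert t.1 t.2} =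
      range fun k : Fin n => ((opp * P.nextTile) ^ (k : ℕ)) t := by
    ext t'
    constructor
    · intro h
      exact hP.pow_apply_rep t (Eq.symm h)
    · rintro ⟨k, rfl⟩
      exact ((hP.vert_eq_iff _ _).2 ⟨(k : ℕ), by simp⟩).symm
  rw [this, ← image_univ, ncard_image_of_injective _ hinj, ncard_univ, Nat.card_eq_fintype_card,
    Fintype.card_fin]

theorem isSubdivision (hP : P.IsRegular n opp rep) (α β γ δ ε : ℝ) :
    (P.pentagonalSubdivision α β γ δ ε).IsSubdivision n P.nextTile opp where
  kinds := by
    refine ⟨?_, ?_⟩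
    · intro t t' i j h
      replace h : P.subdivCorner t i = P.subdivCorner t' j := h
      rcases ZMod.five_cases i with rfl | rfl | rfl | rfl | rfl <;>
      rcases ZMod.five_cases j with rfl | rfl | rfl | rfl | rfl <;>
      first
        | rfl
        | exact SubdivVertex.noConfusion h
        | cases h
    · intro t t' i h hi
      replace h : P.subdivCorner t i = P.subdivCorner t' i := h
      rcases ZMod.five_cases i with rfl | rfl | rfl | rfl | rfl
      · exact absurd hi (by decide)
      · obtain ⟨h1, h2⟩ := SubdivVertex.third.inj h
        exact hP.dart_injective h1 h2
      · exact absurd hi (by decide)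
      · obtain ⟨h1, h2⟩ := SubdivVertex.third.inj h
        -- Corner 3 lies on the edge that enters the vertex, which starts at index `t.2 - 1`.
        have := hP.dart_injective (t := (t.1, t.2 - 1)) (t' := (t'.1, t'.2 - 1)) h1 (by simpa using h2)
        exact Prod.ext (Prod.ext_iff.1 this).1 (sub_left_injective (Prod.ext_iff.1 this).2)
      · obtain ⟨h1, h2⟩ := SubdivVertex.third.inj h
        have := hP.dart_injective (t := (t.1, t.2 - 1)) (t' := (t'.1, t'.2 - 1)) h2 (by simpa using h1)
        exact Prod.ext (Prod.ext_iff.1 this).1 (sub_left_injective (Prod.ext_iff.1 this).2)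
  z_mul_z := Equiv.ext fun t => hP.opp_opp t.1 t.2
  y_pow := nextTile_pow_three
  zy_pow := hP.pow_eq_one
  corner_zero t t' := Iff.trans ⟨SubdivVertex.old.inj, congrArg SubdivVertex.old⟩
    (hP.vert_eq_iff t t')
  corner_two t t' := Iff.trans ⟨SubdivVertex.center.inj, congrArg SubdivVertex.center⟩
    (sameCycle_nextTile_iff t t').symm
  corner_one_three t := by
    have h : t.2 + 1 - 1 = t.2 := add_sub_cancel_right _ _
    exact congrArg₂ SubdivVertex.third (congrArg (P.vert t.1) h.symm) rfl
  corner_one_four t := by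
    have h1 := hP.vert_opp t.1 (t.2 + 1)
    have h2 := hP.vert_opp_pred t.1 (t.2 + 1)
    rw [add_sub_cancel_right] at h1
    exact congrArg₂ SubdivVertex.third h1.symm h2.symm
  side_eq_iff _ _ _ _ := Iff.rfl

end IsRegular

end TriangularPolyhedron

deriving instance DecidableEq for OctahedronVertex
deriving instance DecidableEq for OctahedronFace
deriving instance DecidableEq for IcosahedronVertex
deriving instance DecidableEq for IcosahedronFace

instance : DecidableEq octahedron.Vertex := inferInstanceAs (DecidableEq OctahedronVertex)

instance : DecidableEq icosahedron.Vertex := inferInstanceAs (DecidableEq IcosahedronVertex)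

/-- The other side along the same edge of the octahedron. -/
def octahedronOpp : OctahedronFace × ZMod 3 → OctahedronFace × ZMod 3
  | (.upper i, j) => ![(.upper (i + 1), 1), (.upper (i - 1), 0), (.lower i, 2)] j
  | (.lower i, j) => ![(.lower (i - 1), 1), (.lower (i + 1), 0), (.upper i, 2)] j

/-- A corner at each vertex of the octahedron. -/
def octahedronRep : OctahedronVertex → OctahedronFace × ZMod 3
  | .north => (.upper 0, 0)
  | .south => (.lower 0, 0)
  | .equator i => (.upper i, 1)

lemma octahedronOpp_involutive : Function.Involutive octahedronOpp := by
  rintro ⟨i | i, j⟩ <;> revert i j <;> decide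

/-- `octahedronOpp` as a permutation. -/
def octahedronOppPerm : Equiv.Perm (octahedron.Face × ZMod 3) := octahedronOpp_involutive.toPerm

lemma octahedron_isRegular :
    octahedron.IsRegular 4 octahedronOppPerm octahedronRep where
  opp_opp f j := octahedronOpp_involutive (f, j)
  vert_opp := by
    show ∀ f j, octahedron.vert (octahedronOpp (f, j)).1 (octahedronOpp (f, j)).2 =
      octahedron.vert f (j - 1)
    rintro (i | i) <;> revert i <;> decide
  vert_opp_pred := by
    show ∀ f j, octahedron.vert (octahedronOpp (f, j)).1 ((octahedronOpp (f, j)).2 - 1) =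
      octahedron.vert f j
    rintro (i | i) <;> revert i <;> decide
  exists_rep := by
    show ∀ (f : OctahedronFace) (j : ZMod 3), ∃ k : Fin 4,
      (fun t : OctahedronFace × ZMod 3 => octahedronOpp (t.1, t.2 + 1))^[k]
      (octahedronRep (octahedron.vert f j)) = (f, j)
    rintro (i | i) <;> revert i <;> decide
  iterate_eq := by
    show ∀ f j, (fun t => octahedronOpp (t.1, t.2 + 1))^[4] (f, j) = (f, j)
    rintro (i | i) <;> revert i <;> decide
  iterate_free := by
    have : ∀ f j (k : Fin 4), (k : ℕ) ≠ 0 → octahedron.vert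
        ((fun t => octahedronOpp (t.1, t.2 + 1))^[k] (f, j)).1
        (((fun t => octahedronOpp (t.1, t.2 + 1))^[k] (f, j)).2 + 1) ≠
        octahedron.vert f (j + 1) := by
      rintro (i | i) <;> revert i <;> decide
    rintro f j k hk _ rfl
    exact this f j k hk

/-- The other side along the same edge of the icosahedron. -/
def icosahedronOpp : IcosahedronFace × ZMod 3 → IcosahedronFace × ZMod 3
  | (.northCap i, j) => ![(.northCap (i + 1), 1), (.northCap (i - 1), 0), (.upperBelt i, 0)] j
  | (.upperBelt i, j) => ![(.northCap i, 2), (.lowerBelt (i - 1), 2), (.lowerBelt i, 0)] j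
  | (.lowerBelt i, j) => ![(.upperBelt i, 2), (.southCap i, 2), (.upperBelt (i + 1), 1)] j
  | (.southCap i, j) => ![(.southCap (i - 1), 1), (.southCap (i + 1), 0), (.lowerBelt i, 1)] j

/-- A corner at each vertex of the icosahedron. -/
def icosahedronRep : IcosahedronVertex → IcosahedronFace × ZMod 3
  | .north => (.northCap 0, 0)
  | .south => (.southCap 0, 0)
  | .up i => (.northCap i, 1)
  | .down i => (.lowerBelt i, 0)

lemma icosahedronOpp_involutive : Function.Involutive icosahedronOpp := by
  rintro ⟨i | i | i | i, j⟩ <;> revert i j <;> decide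

/-- `icosahedronOpp` as a permutation. -/
def icosahedronOppPerm : Equiv.Perm (icosahedron.Face × ZMod 3) := icosahedronOpp_involutive.toPerm

lemma icosahedron_isRegular :
    icosahedron.IsRegular 5 icosahedronOppPerm icosahedronRep where
  opp_opp f j := icosahedronOpp_involutive (f, j)
  vert_opp := by
    show ∀ f j, icosahedron.vert (icosahedronOpp (f, j)).1 (icosahedronOpp (f, j)).2 =
      icosahedron.vert f (j - 1)
    rintro (i | i | i | i) <;> revert i <;> decide
  vert_opp_pred := by
    show ∀ f j, icosahedron.vert (icosahedronOpp (f, j)).1 ((icosahedronOpp (f, j)).2 - 1) =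
      icosahedron.vert f j
    rintro (i | i | i | i) <;> revert i <;> decide
  exists_rep := by
    show ∀ (f : IcosahedronFace) (j : ZMod 3), ∃ k : Fin 5,
      (fun t : IcosahedronFace × ZMod 3 => icosahedronOpp (t.1, t.2 + 1))^[k]
      (icosahedronRep (icosahedron.vert f j)) = (f, j)
    rintro (i | i | i | i) <;> revert i <;> decide
  iterate_eq := by
    show ∀ f j, (fun t => icosahedronOpp (t.1, t.2 + 1))^[5] (f, j) = (f, j)
    rintro (i | i | i | i) <;> revert i <;> decide
  iterate_free := by
    have : ∀ f j (k : Fin 5), (k : ℕ) ≠ 0 → icosahedron.vert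
        ((fun t => icosahedronOpp (t.1, t.2 + 1))^[k] (f, j)).1
        (((fun t => icosahedronOpp (t.1, t.2 + 1))^[k] (f, j)).2 + 1) ≠
        icosahedron.vert f (j + 1) := by
      rintro (i | i | i | i) <;> revert i <;> decide
    rintro f j k hk _ rfl
    exact this f j k hk

/-! ### The two polyhedra are connected -/

lemma mem_iff_of_pow {X : Type*} {f : Equiv.Perm X} {k : ℕ} (hf : f ^ (k + 1) = 1) {S : Set X}
    (hS : ∀ t ∈ S, f t ∈ S) (t : X) : f t ∈ S ↔ t ∈ S := by
  refine ⟨fun h => ?_, hS t⟩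
  have hpow : ∀ k : ℕ, ∀ t ∈ S, (f ^ k) t ∈ S := by
    intro k
    induction k with
    | zero => exact fun t ht => ht
    | succ k ih => intro t ht; rw [pow_succ, Equiv.Perm.mul_apply]; exact ih _ (hS t ht)
  have h1 := hpow k _ h
  rwa [← Equiv.Perm.mul_apply, ← pow_succ, hf] at h1

/-- An invariant set of tiles consists of whole faces. -/
lemma TriangularPolyhedron.IsRegular.mem_of_closed {P : TriangularPolyhedron} {n : ℕ}
    {opp : Equiv.Perm (P.Face × ZMod 3)} {rep : P.Vertex → P.Face × ZMod 3}
    (hP : P.IsRegular n opp rep) {S : Set (P.Face × ZMod 3)} (hS : S.Nonempty)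
    (hy : ∀ t ∈ S, P.nextTile t ∈ S) (hz : ∀ t ∈ S, opp t ∈ S) (f₀ : P.Face)
    (hconn : ∀ F : P.Face → Prop, (∀ f j, F f ↔ F (opp (f, j)).1) → ∀ f, F f ↔ F f₀)
    (t : P.Face × ZMod 3) : t ∈ S := by
  have hy' := mem_iff_of_pow (k := 2) P.nextTile_pow_three hy
  have hz' : ∀ t, opp t ∈ S ↔ t ∈ S := mem_iff_of_pow (k := 1)
    (Equiv.ext fun t => by rw [pow_two]; exact hP.opp_opp t.1 t.2) hz
  have hface : ∀ t t' : P.Face × ZMod 3, t.1 = t'.1 → (t ∈ S ↔ t' ∈ S) := by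
    intro t t' h
    have := ((sameCycle_nextTile_iff t t').2 h).apply_eq_of_invariant (g := (· ∈ S))
      fun t => propext (hy' t)
    exact this.to_iff
  have hF := hconn (fun f => (f, (0 : ZMod 3)) ∈ S) fun f j =>
    (hface (f, 0) (f, j) rfl).trans ((hz' (f, j)).symm.trans (hface _ _ rfl))
  obtain ⟨u, hu⟩ := hS
  exact (hface t (t.1, 0) rfl).2 ((hF t.1).2 ((hF u.1).1 ((hface u (u.1, 0) rfl).1 hu)))

lemma octahedron_mem_of_closed (S : Set (octahedron.Face × ZMod 3)) (hS : S.Nonempty)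
    (hy : ∀ t ∈ S, octahedron.nextTile t ∈ S)
    (hz : ∀ t ∈ S, octahedronOppPerm t ∈ S) (t : octahedron.Face × ZMod 3) :
    t ∈ S := by
  refine octahedron_isRegular.mem_of_closed hS hy hz (.upper 0) (fun F hF => ?_) t
  replace hF : ∀ f j, F f ↔ F (octahedronOpp (f, j)).1 := hF
  have hstep : ∀ i, F (.upper i) ↔ F (.upper (i + 1)) := fun i => hF (.upper i) 0
  have hup : ∀ i, F (.upper i) ↔ F (.upper 0) := by
    intro i
    rw [← ZMod.natCast_zmod_val i]
    induction i.val with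
    | zero => simp
    | succ k ih => rw [Nat.cast_succ, ← hstep, ih]
  rintro (i | i)
  · exact hup i
  · exact (hF (.lower i) 2).trans (hup i)

lemma icosahedron_mem_of_closed (S : Set (icosahedron.Face × ZMod 3)) (hS : S.Nonempty)
    (hy : ∀ t ∈ S, icosahedron.nextTile t ∈ S)
    (hz : ∀ t ∈ S, icosahedronOppPerm t ∈ S) (t : icosahedron.Face × ZMod 3) :
    t ∈ S := by
  refine icosahedron_isRegular.mem_of_closed hS hy hz (.northCap 0) (fun F hF => ?_) t
  replace hF : ∀ f j, F f ↔ F (icosahedronOpp (f, j)).1 := hF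
  have hstep : ∀ i, F (.northCap i) ↔ F (.northCap (i + 1)) := fun i => hF (.northCap i) 0
  have hup : ∀ i, F (.northCap i) ↔ F (.northCap 0) := by
    intro i
    rw [← ZMod.natCast_zmod_val i]
    induction i.val with
    | zero => simp
    | succ k ih => rw [Nat.cast_succ, ← hstep, ih]
  have hbelt : ∀ i, F (.upperBelt i) ↔ F (.northCap 0) := fun i =>
    (hF (.upperBelt i) 0).trans (hup i)
  have hlow : ∀ i, F (.lowerBelt i) ↔ F (.northCap 0) := fun i =>
    (hF (.lowerBelt i) 0).trans (hbelt i)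
  rintro (i | i | i | i)
  · exact hup i
  · exact hbelt i
  · exact hlow i
  · exact (hF (.southCap i) 2).trans (hlow i)

/-- The faces of the octahedron, listed. -/
def octahedronFaceEquiv : OctahedronFace ≃ ZMod 4 ⊕ ZMod 4 where
  toFun | .upper i => .inl i | .lower i => .inr i
  invFun := Sum.elim .upper .lower
  left_inv := by rintro (i | i) <;> rfl
  right_inv := by rintro (i | i) <;> rfl

/-- The faces of the icosahedron, listed. -/
def icosahedronFaceEquiv : IcosahedronFace ≃ (ZMod 5 ⊕ ZMod 5) ⊕ ZMod 5 ⊕ ZMod 5 where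
  toFun
    | .northCap i => .inl (.inl i)
    | .upperBelt i => .inl (.inr i)
    | .lowerBelt i => .inr (.inl i)
    | .southCap i => .inr (.inr i)
  invFun := Sum.elim (Sum.elim .northCap .upperBelt) (Sum.elim .lowerBelt .southCap)
  left_inv := by rintro (i | i | i | i) <;> rfl
  right_inv := by rintro ((i | i) | i | i) <;> rfl

instance : Fintype octahedron.Face := Fintype.ofEquiv _ octahedronFaceEquiv.symm

instance : Fintype icosahedron.Face := Fintype.ofEquiv _ icosahedronFaceEquiv.symm

lemma card_octahedron_face : Fintype.card octahedron.Face = 8 := by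
  exact (Fintype.card_congr (α := octahedron.Face) octahedronFaceEquiv).trans (by simp [ZMod.card])

lemma card_icosahedron_face : Fintype.card icosahedron.Face = 20 := by
  exact (Fintype.card_congr (α := icosahedron.Face) icosahedronFaceEquiv).trans (by simp [ZMod.card])

/-! ### The corners at a vertex -/

namespace AngledComplex

open Classical in
/-- The indices of the corners of tiles that meet at the vertex `p`. -/
def labels (A : AngledComplex) [Fintype A.Tile] (p : A.Vertex) : Multiset (ZMod 5) :=
  (Finset.univ.filter fun c : A.Tile × ZMod 5 => A.corner c.1 c.2 = p).val.map Prod.snd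

variable {A : AngledComplex} [Fintype A.Tile]

lemma mem_labels {p : A.Vertex} {i : ZMod 5} : i ∈ A.labels p ↔ ∃ t, A.corner t i = p := by
  simp [labels]

lemma count_labels (p : A.Vertex) (i : ZMod 5) :
    (A.labels p).count i = {t | A.corner t i = p}.ncard := by
  classical
  rw [labels, Multiset.count_map, ncard_eq_toFinset_card', ← Finset.filter_val]
  refine (Finset.card_bij' (fun t _ => (t, i)) (fun c _ => c.1) ?_ ?_ ?_ ?_).symm <;>
    simp +contextual [eq_comm]

/-- Reduces `HasKinds` to a check on the list of possible vertices. -/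
lemma hasKinds_of_labels {kind : ZMod 5 → Fin 3} (types : List (Multiset (ZMod 5)))
    (hl : ∀ t i, A.labels (A.corner t i) ∈ types)
    (ht : ∀ M ∈ types, (∀ i ∈ M, ∀ j ∈ M, kind i = kind j) ∧
      ∀ i ∈ M, kind i = 1 → M.count i ≤ 1) : A.HasKinds kind where
  kind_eq {t t' i j} h :=
    (ht _ (hl t i)).1 i (mem_labels.2 ⟨t, rfl⟩) j (mem_labels.2 ⟨t', h.symm⟩)
  tile_eq {t t' i} h hi := by
    have h1 := (ht _ (hl t i)).2 i (mem_labels.2 ⟨t, rfl⟩) hi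
    rw [count_labels, ncard_le_one_iff] at h1
    exact h1 rfl h.symm

end AngledComplex

/-! ### From angles at a vertex to corner labels -/

namespace SphereTiling

instance (T : SphereTiling) : Fintype T.complex.Tile := T.fintypeTile

instance (T : SphereTiling) (g : T.Tile → PentagonSymm) :
    Fintype (T.complex.reindex g).Tile := T.fintypeTile

/-- Once all tiles carry the same `θ`, angles are images of corner labels; for injective `θ` they
determine the labels (`labels_mem`). -/
lemma vertexAngles_eq_map_labels (T : SphereTiling) (g : T.Tile → PentagonSymm) {θ : ZMod 5 → ℝ}
    (hg : ∀ t i, T.angle t ((g t).onCorner i) = θ i) (p : S2) :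
    T.vertexAngles p = ((T.complex.reindex g).labels p).map θ := by
  classical
  let e : T.Tile × ZMod 5 ≃ T.Tile × ZMod 5 :=
    Equiv.prodShear (Equiv.refl _) fun t => (g t).cornerEquiv
  have h : (Finset.univ.filter fun c : T.Tile × ZMod 5 => T.corner c.1 c.2 = p) =
      (Finset.univ.filter fun c : T.Tile × ZMod 5 =>
        T.corner c.1 ((g c.1).onCorner c.2) = p).map e.toEmbedding := by
    ext c
    simp only [Finset.mem_filter, Finset.mem_univ, true_and, Finset.mem_map_equiv]
    obtain ⟨d, rfl⟩ := e.surjective c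
    rw [e.symm_apply_apply]
    rfl
  have h' : T.vertexAngles p = ((Finset.univ.filter fun c : T.Tile × ZMod 5 =>
      T.corner c.1 ((g c.1).onCorner c.2) = p).val.map e).map fun c => T.angle c.1 c.2 := by
    rw [vertexAngles]
    convert congrArg (fun s : Finset (T.Tile × ZMod 5) => s.val.map fun c => T.angle c.1 c.2) h
      using 1
    rfl
  rw [h', Multiset.map_map]
  refine (Multiset.map_congr rfl fun c _ => hg c.1 c.2).trans ((Multiset.map_map θ Prod.snd
    (Finset.univ.filter fun c : T.Tile × ZMod 5 =>
      T.corner c.1 ((g c.1).onCorner c.2) = p).val).symm.trans ?_)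
  refine congrArg (Multiset.map θ) (congrArg (fun s : Finset (T.Tile × ZMod 5) =>
    s.val.map Prod.snd) (Finset.ext fun c => ?_))
  rw [Finset.mem_filter_univ]
  exact (Finset.mem_filter_univ (p := fun c : (T.complex.reindex g).Tile × ZMod 5 =>
    (T.complex.reindex g).corner c.1 c.2 = p) c).symm

/-- In a tiling by angle congruent pentagons with five different angles, the corners can be
numbered so that corner 0 is `ε` in each tile, corner 1 or 2 is `δ`, and each other corner has the
same angle in all tiles. -/
lemma exists_reindex (T : SphereTiling) (hT : T.AngleCongruent) (t₀ : T.Tile) {α β γ δ ε : ℝ}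
    (hnd : [α, β, γ, δ, ε].Nodup)
    (h₀ : Finset.univ.val.map (T.angle t₀) = {α, β, γ, δ, ε}) :
    ∃ (θ : ZMod 5 → ℝ) (g : T.Tile → PentagonSymm),
      (∀ t i, T.angle t ((g t).onCorner i) = θ i) ∧ Function.Injective θ ∧ θ 0 = ε ∧
      (θ 1 = δ ∧ ({θ 2, θ 3, θ 4} : Multiset ℝ) = {α, β, γ} ∨
        θ 2 = δ ∧ ({θ 1, θ 3, θ 4} : Multiset ℝ) = {α, β, γ}) := by
  have hinj : Function.Injective (T.angle t₀) := by
    have : (Finset.univ.val.map (T.angle t₀)).Nodup := by rw [h₀]; exact hnd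
    exact fun a b h => Multiset.inj_on_of_nodup_map this a (Finset.mem_univ a) b
      (Finset.mem_univ b) h
  obtain ⟨k, -, hk⟩ := Multiset.mem_map.1 (h₀ ▸ (by simp) : ε ∈ Finset.univ.val.map (T.angle t₀))
  obtain ⟨m, -, hm⟩ := Multiset.mem_map.1 (h₀ ▸ (by simp) : δ ∈ Finset.univ.val.map (T.angle t₀))
  have hne : m ≠ k := by
    rintro rfl
    rw [hm] at hk
    simp [hk] at hnd
  obtain ⟨h, hh0, hh1⟩ : ∃ h : PentagonSymm, h.onCorner 0 = k ∧
      (h.onCorner 1 = m ∨ h.onCorner 2 = m) := by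
    obtain ⟨d, rfl⟩ : ∃ d, m = k + d := ⟨m - k, by ring⟩
    have hd : d = 1 ∨ d = 2 ∨ d = 3 ∨ d = 4 :=
      (ZMod.five_cases d).resolve_left (by rintro rfl; simp at hne)
    -- Offsets 1 and 2 of `δ` from `ε` need a rotation only; a reflection turns 3 into 2 and 4 into
    -- 1.
    rcases hd with rfl | rfl | rfl | rfl
    · exact ⟨⟨false, k⟩, zero_add _, Or.inl (add_comm _ _)⟩
    · exact ⟨⟨false, k⟩, zero_add _, Or.inr (add_comm _ _)⟩
    · exact ⟨⟨true, k⟩, sub_zero _, Or.inr (sub_eq_add_neg _ _)⟩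
    · exact ⟨⟨true, k⟩, sub_zero _, Or.inl (sub_eq_add_neg _ _)⟩
  have hex : ∀ t, ∃ g : PentagonSymm, ∀ i, T.angle t (g.onCorner i) =
      T.angle t₀ (h.onCorner i) := by
    intro t
    obtain ⟨g₁, hg₁⟩ := hT t₀ t
    obtain ⟨g, hg⟩ := g₁.exists_comp h
    exact ⟨g, fun i => by rw [hg, ← hg₁]⟩
  choose g hg using hex
  have hmap : ({T.angle t₀ (h.onCorner 0), T.angle t₀ (h.onCorner 1), T.angle t₀ (h.onCorner 2),
      T.angle t₀ (h.onCorner 3), T.angle t₀ (h.onCorner 4)} : Multiset ℝ) = {α, β, γ, δ, ε} := by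
    rw [← h₀]
    have h1 : (Finset.univ : Finset (ZMod 5)).val.map h.cornerEquiv = Finset.univ.val :=
      congrArg Finset.val (Finset.map_univ_equiv h.cornerEquiv)
    rw [← h1, Multiset.map_map]
    rfl
  rw [hh0, hk] at hmap
  refine ⟨fun i => T.angle t₀ (h.onCorner i), g, hg, hinj.comp h.onCorner_injective,
    by simp only [hh0, hk], ?_⟩
  have hsum : ∀ a b c d e : ℝ, ({a, b, c, d, e} : Multiset ℝ) = {a} + {b} + {c} + {d} + {e} :=
    fun _ _ _ _ _ => rfl
  have hsum3 : ∀ a b c : ℝ, ({a, b, c} : Multiset ℝ) = {a} + {b} + {c} := fun _ _ _ => rfl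
  rw [hsum, hsum] at hmap
  simp only [hsum3]
  rcases hh1 with h1 | h1
  · left
    rw [h1, hm] at hmap
    rw [h1, hm]
    refine ⟨rfl, add_left_cancel (a := {ε} + {δ}) (Eq.trans ?_ (hmap.trans ?_))⟩ <;> abel
  · right
    rw [h1, hm] at hmap
    rw [h1, hm]
    refine ⟨rfl, add_left_cancel (a := {ε} + {δ}) (Eq.trans ?_ (hmap.trans ?_))⟩ <;> abel

lemma vertexAngles_mem (T : SphereTiling) {A : AVC} (hA : T.HasAVC A) (t : T.Tile) (i : ZMod 5) :
    T.vertexAngles (T.corner t i) ∈ A.vertexTypes := by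
  classical
  rw [← hA.vertex_types]
  refine Multiset.mem_map_of_mem _ ?_
  rw [Finset.mem_val, vertices, Finset.mem_image]
  exact ⟨(t, i), Finset.mem_univ _, rfl⟩

lemma labels_mem (T : SphereTiling) (g : T.Tile → PentagonSymm) {θ : ZMod 5 → ℝ}
    (hg : ∀ t i, T.angle t ((g t).onCorner i) = θ i) (hθ : Function.Injective θ)
    (types : List (Multiset (ZMod 5)))
    (h : ∀ t i, T.vertexAngles (T.corner t i) ∈ types.map (Multiset.map θ)) (t : T.Tile)
    (i : ZMod 5) :
    (T.complex.reindex g).labels ((T.complex.reindex g).corner t i) ∈ types := by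
  have h1 := h t ((g t).onCorner i)
  rw [T.vertexAngles_eq_map_labels g hg] at h1
  obtain ⟨M, hM, hM'⟩ := List.mem_map.1 h1
  rw [Multiset.map_injective hθ hM'] at hM
  exact hM

end SphereTiling

/-! ### Exclusion of the vertices `αβγ`, `δ³`, `δε³` -/

namespace AngledComplex

variable {A : AngledComplex}

/-- Side `i` of `t` is glued to side `j` of another tile `t'`. -/
def Glued (A : AngledComplex) (t : A.Tile) (i : ZMod 5) (t' : A.Tile) (j : ZMod 5) : Prop :=
  t' ≠ t ∧ A.side t i = A.side t' j

lemma Glued.symm {t t' : A.Tile} {i j : ZMod 5} (h : A.Glued t i t' j) : A.Glued t' j t i :=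
  ⟨h.1.symm, h.2.symm⟩

lemma IsGlued.side_injective (hA : A.IsGlued) {t : A.Tile} {i j : ZMod 5}
    (h : A.side t i = A.side t j) : i = j := by
  have hends := hA.endpoints _ _ _ _ h
  have : s(i, i + 1) = s(j, j + 1) := by
    apply Sym2.map.injective (hA.corner_inj t)
    simpa using hends
  clear hends h
  revert this
  revert i j
  decide

lemma IsGlued.glued_unique (hA : A.IsGlued) {t t₁ t₂ : A.Tile} {i j₁ j₂ : ZMod 5}
    (h₁ : A.Glued t i t₁ j₁) (h₂ : A.Glued t i t₂ j₂) : t₁ = t₂ ∧ j₁ = j₂ := by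
  obtain rfl := hA.glue_unique t i t₁ t₂ j₁ j₂ h₁.1 h₂.1 h₁.2 h₂.2
  exact ⟨rfl, hA.side_injective (h₁.2.symm.trans h₂.2)⟩

/-- If `δ` is adjacent to `ε`, then each corner `δ` meets a corner `ε`. -/
lemma IsGlued.exists_corner_zero_of_adjacent (hA : A.IsGlued) (hk : A.HasKinds ![0, 0, 1, 1, 1])
    (t : A.Tile) : ∃ t', A.corner t 1 = A.corner t' 0 := by
  -- Only sides 1 and 4 join kind 0 to kind 1 in the way side 1 does without involving corner 1 of a
  -- second tile twice over at kind 1: side 0 has both ends of kind 0, and a partner side 1 would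
  -- repeat corner 2. So the partner is side 4, whose end of kind 0 is `ε`.
  obtain ⟨t', j, hne, hs⟩ := hA.exists_glue t 1
  have hends := hA.endpoints _ _ _ _ hs
  rw [Sym2.eq_iff] at hends
  rcases ZMod.five_cases j with rfl | rfl | rfl | rfl | rfl <;>
    rcases hends with ⟨h1, h2⟩ | ⟨h1, h2⟩ <;>
    first
      | exact absurd (hk.kind_eq h1) (by decide)
      | exact absurd (hk.kind_eq h2) (by decide)
      | exact absurd (hk.tile_eq h2 (by decide)) hne.symm
      | exact ⟨t', h1⟩

/-- No glued complex has vertices `αβγ`, `δ³`, `δε³` with `ε` and `δ` not adjacent. -/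
theorem IsGlued.false_of_mixed_vertex [Fintype A.Tile] (hA : A.IsGlued)
    (hl : ∀ t i, A.labels (A.corner t i) ∈
      ([{1, 3, 4}, {2, 2, 2}, {2, 0, 0, 0}] : List (Multiset (ZMod 5))))
    (t₀ : A.Tile) (ht₀ : A.labels (A.corner t₀ 2) = {2, 2, 2}) : False := by
  -- Corners `ε` and `δ` share kind 0. The tiles at a vertex `δε³` form a cycle `δ`, A, B, C: A
  -- borders the `δ` tile along its side 4, C along its side 0, and B lies between them. A tile with
  -- `δ` at a vertex `δ³` is A or B at its own corner `ε`, and the next tile around `δ³` is of the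
  -- other kind.
  have hk : A.HasKinds ![0, 1, 0, 1, 1] := by
    refine hasKinds_of_labels _ hl fun M hM => ?_
    simp only [List.mem_cons, List.not_mem_nil, or_false] at hM
    rcases hM with rfl | rfl | rfl <;> constructor <;> (simp; try decide)
  have e1 : (1 : ZMod 5) + 1 = 2 := rfl
  have e2 : (2 : ZMod 5) + 1 = 3 := rfl
  have e3 : (3 : ZMod 5) + 1 = 4 := rfl
  have e4 : (4 : ZMod 5) + 1 = 0 := rfl
  -- the ends of glued sides
  have ends : ∀ {t i t' j}, A.Glued t i t' j →
      (A.corner t i = A.corner t' j ∧ A.corner t (i + 1) = A.corner t' (j + 1)) ∨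
      (A.corner t i = A.corner t' (j + 1) ∧ A.corner t (i + 1) = A.corner t' j) :=
    fun h => Sym2.eq_iff.1 (hA.endpoints _ _ _ _ h.2)
  have e04 : ∀ {t t'}, A.Glued t 0 t' 4 →
      A.corner t 0 = A.corner t' 0 ∧ A.corner t 1 = A.corner t' 4 := by
    intro t t' h
    have := ends h
    simp only [zero_add, e4] at this
    rcases this with ⟨h1, -⟩ | h
    · exact absurd (hk.kind_eq h1) (by decide)
    · exact h
  have e02 : ∀ {t t'}, A.Glued t 0 t' 2 →
      A.corner t 0 = A.corner t' 2 ∧ A.corner t 1 = A.corner t' 3 := by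
    intro t t' h
    have := ends h
    simp only [zero_add, e2] at this
    rcases this with h | ⟨h1, -⟩
    · exact h
    · exact absurd (hk.kind_eq h1) (by decide)
  have e12 : ∀ {t t'}, A.Glued t 1 t' 2 →
      A.corner t 1 = A.corner t' 3 ∧ A.corner t 2 = A.corner t' 2 := by
    intro t t' h
    have := ends h
    simp only [e1, e2] at this
    rcases this with ⟨h1, -⟩ | h
    · exact absurd (hk.kind_eq h1) (by decide)
    · exact h
  have e14 : ∀ {t t'}, A.Glued t 1 t' 4 →
      A.corner t 1 = A.corner t' 4 ∧ A.corner t 2 = A.corner t' 0 := by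
    intro t t' h
    have := ends h
    simp only [e1, e4] at this
    rcases this with h | ⟨h1, -⟩
    · exact h
    · exact absurd (hk.kind_eq h1) (by decide)
  have e33 : ∀ {t t'}, A.Glued t 3 t' 3 →
      A.corner t 3 = A.corner t' 4 ∧ A.corner t 4 = A.corner t' 3 := by
    intro t t' h
    have := ends h
    simp only [e3] at this
    rcases this with ⟨h1, -⟩ | h
    · exact absurd (hk.tile_eq h1 (by decide)).symm h.1
    · exact h
  have e42 : ∀ {t t'}, A.Glued t 4 t' 2 → A.corner t 4 = A.corner t' 3 := by
    intro t t' h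
    have := ends h
    simp only [e2, e4] at this
    rcases this with ⟨h1, -⟩ | h
    · exact absurd (hk.kind_eq h1) (by decide)
    · exact h.1
  -- the possible partners of each side
  have partner : ∀ t i, ∃ t' j, A.Glued t i t' j := hA.exists_glue
  have P0 : ∀ t, (∃ t', A.Glued t 0 t' 4) ∨ ∃ t', A.Glued t 0 t' 2 := by
    intro t
    obtain ⟨t', j, h⟩ := partner t 0
    have hends := ends h
    rcases ZMod.five_cases j with rfl | rfl | rfl | rfl | rfl
    case inr.inr.inl => exact Or.inr ⟨t', h⟩
    case inr.inr.inr.inr => exact Or.inl ⟨t', h⟩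
    all_goals
      rcases hends with ⟨h1, h2⟩ | ⟨h1, h2⟩ <;>
      first
        | exact absurd (hk.kind_eq h1) (by decide)
        | exact absurd (hk.kind_eq h2) (by decide)
        | exact absurd (hk.tile_eq h2 (by decide)).symm h.1
  have P1 : ∀ t, (∃ t', A.Glued t 1 t' 2) ∨ ∃ t', A.Glued t 1 t' 4 := by
    intro t
    obtain ⟨t', j, h⟩ := partner t 1
    have hends := ends h
    rcases ZMod.five_cases j with rfl | rfl | rfl | rfl | rfl
    case inr.inr.inl => exact Or.inl ⟨t', h⟩
    case inr.inr.inr.inr => exact Or.inr ⟨t', h⟩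
    all_goals
      rcases hends with ⟨h1, h2⟩ | ⟨h1, h2⟩ <;>
      first
        | exact absurd (hk.kind_eq h1) (by decide)
        | exact absurd (hk.kind_eq h2) (by decide)
        | exact absurd (hk.tile_eq h1 (by decide)).symm h.1
  have P3 : ∀ t, ∃ t', A.Glued t 3 t' 3 := by
    intro t
    obtain ⟨t', j, h⟩ := partner t 3
    have hends := ends h
    rcases ZMod.five_cases j with rfl | rfl | rfl | rfl | rfl
    case inr.inr.inr.inl => exact ⟨t', h⟩
    all_goals
      rcases hends with ⟨h1, h2⟩ | ⟨h1, h2⟩ <;>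
      first
        | exact absurd (hk.kind_eq h1) (by decide)
        | exact absurd (hk.kind_eq h2) (by decide)
  -- tiles at a vertex
  have labels_of_one : ∀ t i, i = 1 ∨ i = 3 ∨ i = 4 → A.labels (A.corner t i) = {1, 3, 4} := by
    intro t i hi
    have h1 : i ∈ A.labels (A.corner t i) := mem_labels.2 ⟨t, rfl⟩
    have h2 := hl t i
    simp only [List.mem_cons, List.not_mem_nil, or_false] at h2
    rcases h2 with h2 | h2 | h2
    · exact h2
    all_goals
      rw [h2] at h1
      exfalso
      rcases hi with rfl | rfl | rfl <;> revert h1 <;> decide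
  have labels_of_zero : ∀ t, A.labels (A.corner t 0) = {2, 0, 0, 0} := by
    intro t
    have h1 : (0 : ZMod 5) ∈ A.labels (A.corner t 0) := mem_labels.2 ⟨t, rfl⟩
    have h2 := hl t 0
    simp only [List.mem_cons, List.not_mem_nil, or_false] at h2
    rcases h2 with h2 | h2 | h2
    · rw [h2] at h1; exact absurd h1 (by decide)
    · rw [h2] at h1; exact absurd h1 (by decide)
    · exact h2
  have two_unique : ∀ {t t' u}, A.corner t 2 = A.corner u 0 → A.corner t' 2 = A.corner u 0 →
      t = t' := by
    intro t t' u h h'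
    have h1 : (A.labels (A.corner u 0)).count 2 ≤ 1 := by rw [labels_of_zero]; decide
    rw [count_labels, ncard_le_one_iff] at h1
    exact h1 h h'
  have exists_two : ∀ u, ∃ t, A.corner t 2 = A.corner u 0 := by
    intro u
    apply mem_labels.1
    rw [labels_of_zero]
    decide
  have ncard_zero : ∀ u, {t | A.corner t 0 = A.corner u 0}.ncard = 3 := by
    intro u
    rw [← count_labels, labels_of_zero]
    decide
  -- sides 0 and 1 of a tile
  have h02_14 : ∀ {t w v}, A.Glued t 0 w 2 → A.Glued t 1 v 2 → False := by
    intro t w v h h'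
    obtain rfl := hk.tile_eq ((e02 h).2.symm.trans (e12 h').1) (by decide)
    exact absurd (hA.side_injective (h.2.trans h'.2.symm)) (by decide)
  have h04_12 : ∀ {t w v}, A.Glued t 0 w 4 → A.Glued t 1 v 4 → False := by
    intro t w v h h'
    obtain rfl := hk.tile_eq ((e04 h).2.symm.trans (e14 h').1) (by decide)
    exact absurd (hA.side_injective (h.2.trans h'.2.symm)) (by decide)
  -- The tile with corner 1 at this vertex already has its side 0 or 1 glued to side 2 of the tile
  -- with corner 3.
  have n42 : ∀ {t t'}, ¬ A.Glued t 4 t' 2 := by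
    intro t t' h
    obtain ⟨u, hu⟩ : ∃ u, A.corner u 1 = A.corner t 4 := by
      apply mem_labels.1
      rw [labels_of_one t 4 (by decide)]
      decide
    have key : ∀ {i w}, i ≠ 4 → A.Glued u i w 2 → A.corner u 1 = A.corner w 3 → False := by
      intro i w hi hw hc
      obtain rfl := hk.tile_eq ((hc.symm.trans hu).trans (e42 h)) (by decide)
      exact hi (hA.glued_unique hw.symm h.symm).2
    rcases P0 u with ⟨w, hw⟩ | ⟨w, hw⟩
    · rcases P1 u with ⟨v, hv⟩ | ⟨v, hv⟩
      · exact key (by decide) hv (e12 hv).1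
      · exact h04_12 hw hv
    · exact key (by decide) hw (e02 hw).2
  have P2 : ∀ t, (∃ t', A.Glued t 2 t' 0) ∨ ∃ t', A.Glued t 2 t' 1 := by
    intro t
    obtain ⟨t', j, h⟩ := partner t 2
    have hends := ends h
    rcases ZMod.five_cases j with rfl | rfl | rfl | rfl | rfl
    case inl => exact Or.inl ⟨t', h⟩
    case inr.inl => exact Or.inr ⟨t', h⟩
    case inr.inr.inr.inr => exact absurd h.symm n42
    all_goals
      rcases hends with ⟨h1, h2⟩ | ⟨h1, h2⟩ <;>
      first
        | exact absurd (hk.kind_eq h1) (by decide)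
        | exact absurd (hk.kind_eq h2) (by decide)
        | exact absurd (hk.tile_eq h2 (by decide)).symm h.1
  have P4 : ∀ t, (∃ t', A.Glued t 4 t' 0) ∨ ∃ t', A.Glued t 4 t' 1 := by
    intro t
    obtain ⟨t', j, h⟩ := partner t 4
    have hends := ends h
    rcases ZMod.five_cases j with rfl | rfl | rfl | rfl | rfl
    case inl => exact Or.inl ⟨t', h⟩
    case inr.inl => exact Or.inr ⟨t', h⟩
    case inr.inr.inl => exact absurd h n42
    all_goals
      rcases hends with ⟨h1, h2⟩ | ⟨h1, h2⟩ <;>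
      first
        | exact absurd (hk.kind_eq h1) (by decide)
        | exact absurd (hk.kind_eq h2) (by decide)
        | exact absurd (hk.tile_eq h1 (by decide)).symm h.1
  -- the tile opposite to side 3
  have opp : ∀ {t t'}, A.corner t 3 = A.corner t' 4 → A.Glued t 3 t' 3 := by
    intro t t' h
    obtain ⟨u, hu⟩ := P3 t
    rwa [← hk.tile_eq ((e33 hu).1.symm.trans h) (by decide)]
  -- a tile whose corner 2 is at a vertex `δε³`
  have two_of_mixed : ∀ {w u}, A.corner w 2 = A.corner u 0 →
      (∃ v, A.Glued w 1 v 4) ∧ (∃ r, A.Glued w 0 r 2) ∧ ∃ r, A.Glued w 2 r 0 := by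
    intro w u h
    -- Side 1 glued to a side 2 would bring a second `δ` to the vertex.
    have h1 : ∃ v, A.Glued w 1 v 4 := by
      rcases P1 w with ⟨v, hv⟩ | hv
      · exact absurd (two_unique (((e12 hv).2.symm).trans h) h) hv.1
      · exact hv
    refine ⟨h1, ?_, ?_⟩
    · obtain ⟨v, hv⟩ := h1
      rcases P0 w with ⟨r, hr⟩ | hr
      · exact (h04_12 hr hv).elim
      · exact hr
    · rcases P2 w with hr | ⟨r, hr⟩
      · exact hr
      · exact absurd (two_unique (((e12 hr.symm).2).trans h) h) hr.1
  -- Across side 3, C becomes A: the tile `u` on side 2 of `w` has its side 1 on side 4 of some `x`,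
  -- and at corner 1 of `u` the tile `x` is seen to be `v`. `A_imp_C` reverses this.
  have C_imp_A : ∀ {w v r}, A.Glued w 0 r 2 → A.Glued w 3 v 3 → ∃ u, A.Glued v 4 u 1 := by
    intro w v r hr hv
    have hmix : ∃ u, A.Glued w 2 u 0 := by
      rcases P1 w with ⟨x, hx⟩ | ⟨x, hx⟩
      · exact (h02_14 hr hx).elim
      · exact (two_of_mixed (e14 hx).2).2.2
    obtain ⟨u, hu⟩ := hmix
    rcases P1 u with ⟨x, hx⟩ | ⟨x, hx⟩
    · exact (h02_14 hu.symm hx).elim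
    · have h1 : A.corner w 3 = A.corner x 4 := (e02 hu.symm).2.symm.trans (e14 hx).1
      rw [(hA.glued_unique hv (opp h1)).1]
      exact ⟨u, hx.symm⟩
  have A_imp_C : ∀ {v w u}, A.Glued v 4 u 1 → A.Glued v 3 w 3 → ∃ r, A.Glued w 0 r 2 := by
    intro v w u hu hw
    rcases P0 u with ⟨x, hx⟩ | ⟨x, hx⟩
    · exact (h04_12 hx hu.symm).elim
    · have h1 : A.corner x 3 = A.corner v 4 := (e02 hx).2.symm.trans (e14 hu.symm).1
      rw [(hA.glued_unique hw (opp h1).symm).1]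
      exact (two_of_mixed (e02 hx).1.symm).2.1
  -- kinds of corners for the sides at corner 0
  have corner_zero_side : ∀ {t t' i}, (A.corner t i = A.corner t' 0 ∨
      A.corner t (i + 1) = A.corner t' 0) → A.corner t 0 = A.corner t' 0 → i = 0 ∨ i = 4 := by
    intro t t' i h h0
    have := h.imp (fun h => hA.corner_inj t (h.trans h0.symm))
      (fun h => hA.corner_inj t (h.trans h0.symm))
    clear h h0
    revert i; decide
  have corner_two_side : ∀ {t t' i}, (A.corner t i = A.corner t' 0 ∨
      A.corner t (i + 1) = A.corner t' 0) → A.corner t 2 = A.corner t' 0 → i = 1 ∨ i = 2 := by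
    intro t t' i h h0
    have := h.imp (fun h => hA.corner_inj t (h.trans h0.symm))
      (fun h => hA.corner_inj t (h.trans h0.symm))
    clear h h0
    revert i; decide
  -- If C followed A directly, the cycle at the vertex would close with two `ε` instead of three.
  have A_next : ∀ {t u r w}, A.Glued t 4 u 1 → A.Glued t 0 r 4 → A.Glued r 0 w 2 → False := by
    intro t u r w hu hr hw
    have hup : A.corner u 2 = A.corner t 0 := (e14 hu.symm).2
    have hrp : A.corner r 0 = A.corner t 0 := (e04 hr).1.symm
    obtain rfl := two_unique ((e02 hw).1.symm.trans hrp) hup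
    have hall := hA.link (A.corner t 0) {w, t, r} ⟨t, by simp, 0, rfl⟩ (by
      intro s hs i s' j hi hij
      by_cases hss : s' = s
      · rwa [hss]
      have hg : A.Glued s i s' j := ⟨hss, hij⟩
      rcases hs with rfl | rfl | rfl
      · rcases corner_two_side hi hup with rfl | rfl
        · simp [(hA.glued_unique hg hu.symm).1]
        · simp [(hA.glued_unique hg hw.symm).1]
      · rcases corner_zero_side hi rfl with rfl | rfl
        · simp [(hA.glued_unique hg hr).1]
        · simp [(hA.glued_unique hg hu).1]
      · rcases corner_zero_side hi hrp with rfl | rfl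
        · simp [(hA.glued_unique hg hw).1]
        · simp [(hA.glued_unique hg hr.symm).1])
    have hsub : {s | A.corner s 0 = A.corner t 0} ⊆ {t, r} := by
      intro s hs
      rcases hall s 0 hs with rfl | h
      · exact absurd (hA.corner_inj _ (hup.trans (Eq.symm hs))) (by decide)
      · exact h
    have := (ncard_le_ncard hsub).trans (ncard_insert_le t {r})
    rw [ncard_zero, ncard_singleton] at this
    omega
  -- B and its two neighbours are the three `ε` tiles, and side 0 of `t` and of `t₁` is on a side 4;
  -- so it is `r` that borders the `δ` tile along side 0.
  have B_next : ∀ {t t₁ r}, A.Glued t 4 t₁ 0 → A.Glued t 0 r 4 → ∃ w, A.Glued r 0 w 2 := by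
    intro t t₁ r h₁ hr
    have hp₁ : A.corner t₁ 0 = A.corner t 0 := (e04 h₁.symm).1
    have hrp : A.corner r 0 = A.corner t 0 := (e04 hr).1.symm
    obtain ⟨u, hu⟩ := exists_two t
    obtain ⟨w, hw⟩ := (two_of_mixed hu).2.2
    have hwp : A.corner w 0 = A.corner t 0 := (e02 hw.symm).1.trans hu
    have hne : t₁ ≠ r := by
      rintro rfl
      have hall := hA.link (A.corner t 0) {t, t₁} ⟨t, by simp, 0, rfl⟩ (by
        intro s hs i s' j hi hij
        by_cases hss : s' = s
        · rwa [hss]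
        have hg : A.Glued s i s' j := ⟨hss, hij⟩
        rcases hs with rfl | rfl
        · rcases corner_zero_side hi rfl with rfl | rfl
          · simp [(hA.glued_unique hg hr).1]
          · simp [(hA.glued_unique hg h₁).1]
        · rcases corner_zero_side hi hp₁ with rfl | rfl
          · simp [(hA.glued_unique hg h₁.symm).1]
          · simp [(hA.glued_unique hg hr.symm).1])
      rcases hall u 2 hu with rfl | rfl
      · exact absurd (hA.corner_inj _ hu) (by decide)
      · exact absurd (hA.corner_inj _ (hu.trans hp₁.symm)) (by decide)
    have hset : ({t, t₁, r} : Set A.Tile) = {s | A.corner s 0 = A.corner t 0} := by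
      refine eq_of_subset_of_ncard_le ?_ ?_ (toFinite _)
      · rintro s (rfl | rfl | rfl)
        · rfl
        · exact hp₁
        · exact hrp
      · rw [ncard_zero, ncard_insert_of_notMem, ncard_pair hne]
        rintro (rfl | rfl)
        · exact h₁.1 rfl
        · exact hr.1 rfl
    have hwm : w ∈ ({t, t₁, r} : Set A.Tile) := hset ▸ hwp
    rcases hwm with rfl | rfl | rfl
    · exact absurd (hA.glued_unique hw.symm hr).2 (by decide)
    · exact absurd (hA.glued_unique hw.symm h₁.symm).2 (by decide)
    · exact ⟨u, hw.symm⟩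
  -- rotation around a vertex `δ³`
  have rot : ∀ t, A.corner t 2 = A.corner t₀ 2 → ∃ t', A.corner t' 2 = A.corner t₀ 2 ∧
      A.corner t 1 = A.corner t' 3 ∧
      ((∃ u, A.Glued t' 4 u 1) ↔ ¬ ∃ u, A.Glued t 4 u 1) := by
    intro t ht
    obtain ⟨y, hy⟩ : ∃ y, A.Glued t 1 y 2 := by
      rcases P1 t with h | ⟨y, hy⟩
      · exact h
      · have : (0 : ZMod 5) ∈ A.labels (A.corner t₀ 2) :=
          mem_labels.2 ⟨y, (e14 hy).2.symm.trans ht⟩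
        rw [ht₀] at this
        exact absurd this (by decide)
    obtain ⟨r, hr⟩ : ∃ r, A.Glued t 0 r 4 := by
      rcases P0 t with h | ⟨r, hr⟩
      · exact h
      · exact (h02_14 hr hy).elim
    -- The neighbours `y` and `r` of `t` share side 3, so `y` is A exactly when `r` is C.
    have hz : A.Glued y 3 r 3 := opp ((e12 hy).1.symm.trans (e04 hr).2)
    refine ⟨y, (e12 hy).2.symm.trans ht, (e12 hy).1, ?_, ?_⟩
    · rintro ⟨u, hu⟩ ⟨v, hv⟩
      obtain ⟨w, hw⟩ := A_imp_C hu hz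
      exact A_next hv hr hw
    · intro h
      rcases P4 t with ⟨t₁, h₁⟩ | h'
      · obtain ⟨w, hw⟩ := B_next h₁ hr
        exact C_imp_A hw hz.symm
      · exact absurd h' h
  choose! y hy2 hy13 hyA using rot
  classical
  let S : Finset A.Tile := Finset.univ.filter fun t => A.corner t 2 = A.corner t₀ 2
  have hS : S.card = 3 := by
    have h1 := count_labels (A.corner t₀ 2) 2
    rw [ht₀, ncard_eq_toFinset_card'] at h1
    have h2 : S = {t | A.corner t 2 = A.corner t₀ 2}.toFinset := by ext t; simp [S]
    rw [h2, ← h1]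
    decide
  have hinj : ∀ t ∈ S, ∀ t' ∈ S, y t = y t' → t = t' := by
    intro t ht t' ht' h
    have h1 := hy13 t (by simpa [S] using ht)
    have h2 := hy13 t' (by simpa [S] using ht')
    rw [h] at h1
    exact hk.tile_eq (h1.trans h2.symm) (by decide)
  let Q : A.Tile → Prop := fun t => ∃ u, A.Glued t 4 u 1
  have hQ : ∀ t ∈ S, y t ∈ S ∧ (Q (y t) ↔ ¬ Q t) := by
    intro t ht
    have ht' : A.corner t 2 = A.corner t₀ 2 := by simpa [S] using ht
    exact ⟨by simpa [S] using hy2 t ht', hyA t ht'⟩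
  -- Since `y` exchanges `Q` and its negation injectively on `S`, both classes have equal size, but
  -- `S` has three elements.
  have h1 : (S.filter Q).card ≤ (S.filter fun t => ¬ Q t).card := by
    apply Finset.card_le_card_of_injOn y
    · intro t ht
      have ht := Finset.mem_filter.1 (Finset.mem_coe.1 ht)
      exact Finset.mem_coe.2 (Finset.mem_filter.2
        ⟨(hQ t ht.1).1, fun h => ((hQ t ht.1).2.1 h) ht.2⟩)
    · intro t ht t' ht' h
      exact hinj t (Finset.mem_filter.1 (Finset.mem_coe.1 ht)).1 t'
        (Finset.mem_filter.1 (Finset.mem_coe.1 ht')).1 h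
  have h2 : (S.filter fun t => ¬ Q t).card ≤ (S.filter Q).card := by
    apply Finset.card_le_card_of_injOn y
    · intro t ht
      have ht := Finset.mem_filter.1 (Finset.mem_coe.1 ht)
      exact Finset.mem_coe.2 (Finset.mem_filter.2 ⟨(hQ t ht.1).1, (hQ t ht.1).2.2 ht.2⟩)
    · intro t ht t' ht' h
      exact hinj t (Finset.mem_filter.1 (Finset.mem_coe.1 ht)).1 t'
        (Finset.mem_filter.1 (Finset.mem_coe.1 ht')).1 h
  have h3 := Finset.card_filter_add_card_filter_not (s := S) Q
  omega

end AngledComplex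

/-! ### Corner labels under isomorphism and in subdivisions -/

namespace AngledComplex

variable {A B : AngledComplex} [Fintype A.Tile] [Fintype B.Tile]

lemma labels_eq_of_mem {types : List (Multiset (ZMod 5))} {p : A.Vertex} (h : A.labels p ∈ types)
    {i : ZMod 5} (hi : i ∈ A.labels p) {M : Multiset (ZMod 5)}
    (hM : ∀ M' ∈ types, i ∈ M' → M' = M) : A.labels p = M := hM _ h hi

/-- The corners at a vertex correspond under an isomorphism. -/
lemma labels_eq_of_equiv (e : A.Tile ≃ B.Tile)
    (h : ∀ t t' i j, A.corner t i = A.corner t' j ↔ B.corner (e t) i = B.corner (e t') j)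
    (t : A.Tile) (i : ZMod 5) : A.labels (A.corner t i) = B.labels (B.corner (e t) i) := by
  ext j
  rw [count_labels, count_labels, ← ncard_image_of_injective _ e.injective]
  congr 1
  ext u
  obtain ⟨u, rfl⟩ := e.surjective u
  simp [h]

lemma IsSubdivision.labels_of_kind_one {n : ℕ} {y z : Equiv.Perm A.Tile}
    (hA : A.IsSubdivision n y z) (t : A.Tile) {i : ZMod 5} (hi : i = 1 ∨ i = 3 ∨ i = 4) :
    A.labels (A.corner t i) = {1, 3, 4} := by
  rw [hA.corner_eq_rotation t hi]
  generalize rotation y z i t = t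
  have h1 : ∀ j u, A.corner u j = A.corner t 1 → (![0, 1, 2, 1, 1] : ZMod 5 → Fin 3) j = 1 →
      {v | A.corner v j = A.corner t 1}.ncard = 1 := by
    intro j u hu hj
    rw [ncard_eq_one]
    refine ⟨u, Set.ext fun v => ⟨fun hv => ?_, ?_⟩⟩
    · exact hA.kinds.tile_eq (Eq.trans hv hu.symm) hj
    · rintro rfl
      exact hu
  have h0 : ∀ j : ZMod 5, (![0, 1, 2, 1, 1] : ZMod 5 → Fin 3) j ≠ 1 →
      {v | A.corner v j = A.corner t 1}.ncard = 0 := by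
    intro j hj
    rw [ncard_eq_zero]
    ext v
    simp only [mem_ofPred_eq, mem_empty_iff_false, iff_false]
    exact fun hv => hj (hA.kinds.kind_eq hv)
  ext j
  rw [count_labels]
  rcases ZMod.five_cases j with rfl | rfl | rfl | rfl | rfl
  · rw [h0 0 (by decide)]; decide
  · rw [h1 1 t rfl rfl]; decide
  · rw [h0 2 (by decide)]; decide
  · rw [h1 3 _ (hA.corner_one_three t).symm rfl]; decide
  · rw [h1 4 _ (hA.corner_one_four t).symm rfl]; decide

lemma labels_eq_replicate {t : A.Tile} {i : ZMod 5} {n : ℕ}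
    (h : ∀ t' j, A.corner t' j = A.corner t i → j = i)
    (hn : {t' | A.corner t' i = A.corner t i}.ncard = n) :
    A.labels (A.corner t i) = Multiset.replicate n i := by
  have hall : ∀ j ∈ A.labels (A.corner t i), j = i := fun j hj => by
    obtain ⟨t', ht'⟩ := mem_labels.1 hj
    exact h t' j ht'
  have h1 := Multiset.eq_replicate_card.2 hall
  rw [← hn, ← count_labels, Multiset.count_eq_card.2 fun j hj => (hall j hj).symm]
  exact h1

end AngledComplex

lemma card_filter_eq_ncard {X : Type*} [Fintype X] (p : X → Prop) {_ : DecidablePred p} :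
    (Finset.univ.filter p).card = {x | p x}.ncard := by
  rw [← ncard_coe_finset]
  simp

lemma ncard_range_mk {X : Type*} (x : X) : (range fun j : ZMod 3 => (x, j)).ncard = 3 := by
  rw [← image_univ, ncard_image_of_injective _ (Prod.mk_right_injective x), ncard_univ,
    Nat.card_eq_fintype_card, ZMod.card]

/-! ### Angle combinations against pentagonal subdivisions -/

namespace SphereTiling

variable (T : SphereTiling)

/-- A tiling with the angles of a pentagonal subdivision at its vertices is isomorphic to it. -/
theorem exists_isomorphic (hT : T.AngleCongruent) {α β γ δ ε : ℝ}
    (hnd : [α, β, γ, δ, ε].Nodup) {P : TriangularPolyhedron} [Fintype P.Face] {n N : ℕ}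
    {opp : Equiv.Perm (P.Face × ZMod 3)} {rep : P.Vertex → P.Face × ZMod 3}
    (hP : P.IsRegular n opp rep)
    (hclosed : ∀ S : Set (P.Face × ZMod 3), S.Nonempty → (∀ t ∈ S, P.nextTile t ∈ S) →
      (∀ t ∈ S, opp t ∈ S) → ∀ t, t ∈ S)
    (hbound : ∀ (X : Type) (y z : Equiv.Perm X), z * z = 1 → y ^ 3 = 1 → (z * y) ^ n = 1 →
      ∀ t, ∃ S : Set X, S.Finite ∧ S.ncard ≤ N ∧ t ∈ S ∧ (∀ u ∈ S, y u ∈ S) ∧ ∀ u ∈ S, z u ∈ S)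
    (hcard : Fintype.card T.Tile = N) (hcard' : Fintype.card P.Face * 3 = N) (hN : N ≠ 0)
    (htile : ∀ t, Finset.univ.val.map (T.angle t) = {α, β, γ, δ, ε})
    (hv : ∀ t i, T.vertexAngles (T.corner t i) ∈
      ([{α, β, γ}, {δ, δ, δ}, Multiset.replicate n ε] : List (Multiset ℝ))) :
    ∃ a b c : ℝ, ({a, b, c} : Multiset ℝ) = {α, β, γ} ∧
      T.complex.Isomorphic (P.pentagonalSubdivision a b c δ ε) := by
  have hne : Nonempty T.Tile := Fintype.card_pos_iff.1 (by omega)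
  obtain ⟨t₀⟩ := hne
  obtain ⟨θ, g, hg, hθ, h0, h⟩ := T.exists_reindex hT t₀ hnd (htile t₀)
  have hG := T.isGlued_complex.reindex g
  rcases h with ⟨h1, habc⟩ | ⟨h2, habc⟩
  · have hl := T.labels_mem g hg hθ [{2, 3, 4}, {1, 1, 1}, Multiset.replicate n 0] (by
      rw [← habc] at hv
      simpa [h0, h1] using hv)
    have hk : (T.complex.reindex g).HasKinds ![0, 2, 1, 1, 1] := by
      refine AngledComplex.hasKinds_of_labels _ hl fun M hM => ?_
      simp only [List.mem_cons, List.not_mem_nil, or_false] at hM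
      rcases hM with rfl | rfl | rfl
      · constructor <;> (simp; try decide)
      · constructor <;> (simp; try decide)
      · constructor
        · intro i hi j hj
          rw [Multiset.eq_of_mem_replicate hi, Multiset.eq_of_mem_replicate hj]
        · intro i hi h
          rw [Multiset.eq_of_mem_replicate hi] at h
          exact absurd h (by decide)
    exact (hG.false_of_adjacent hk t₀).elim
  · have hl := T.labels_mem g hg hθ [{1, 3, 4}, {2, 2, 2}, Multiset.replicate n 0] (by
      rw [← habc] at hv
      simpa [h0, h2] using hv)
    have hk : (T.complex.reindex g).HasKinds ![0, 1, 2, 1, 1] := by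
      refine AngledComplex.hasKinds_of_labels _ hl fun M hM => ?_
      simp only [List.mem_cons, List.not_mem_nil, or_false] at hM
      rcases hM with rfl | rfl | rfl
      · constructor <;> (simp; try decide)
      · constructor <;> (simp; try decide)
      · constructor
        · intro i hi j hj
          rw [Multiset.eq_of_mem_replicate hi, Multiset.eq_of_mem_replicate hj]
        · intro i hi h
          rw [Multiset.eq_of_mem_replicate hi] at h
          exact absurd h (by decide)
    have hl0 : ∀ t, (T.complex.reindex g).labels ((T.complex.reindex g).corner t 0) =
        Multiset.replicate n 0 := by
      intro t
      refine AngledComplex.labels_eq_of_mem (hl t 0) (AngledComplex.mem_labels.2 ⟨t, rfl⟩) ?_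
      intro M hM h0
      simp only [List.mem_cons, List.not_mem_nil, or_false] at hM
      rcases hM with rfl | rfl | rfl
      · exact absurd h0 (by decide)
      · exact absurd h0 (by decide)
      · rfl
    have hl2 : ∀ t, (T.complex.reindex g).labels ((T.complex.reindex g).corner t 2) =
        {2, 2, 2} := by
      intro t
      refine AngledComplex.labels_eq_of_mem (hl t 2) (AngledComplex.mem_labels.2 ⟨t, rfl⟩) ?_
      intro M hM h0
      simp only [List.mem_cons, List.not_mem_nil, or_false] at hM
      rcases hM with rfl | rfl | rfl
      · exact absurd h0 (by decide)
      · rfl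
      · exact absurd (Multiset.eq_of_mem_replicate h0) (by decide)
    obtain ⟨y, z, hyz⟩ := hG.exists_isSubdivision hk (n := n)
      (fun t => by rw [← AngledComplex.count_labels, hl0, Multiset.count_replicate_self])
      (fun t => by rw [← AngledComplex.count_labels, hl2]; decide)
    have : Fintype (P.pentagonalSubdivision (θ 1) (θ 3) (θ 4) δ ε).Tile :=
      inferInstanceAs (Fintype (P.Face × ZMod 3))
    obtain ⟨e, hcorner, hside⟩ := AngledComplex.exists_equiv_of_isSubdivision hyz hG
      (hP.isSubdivision (θ 1) (θ 3) (θ 4) δ ε) hclosed (hbound _)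
      ((Nat.card_eq_fintype_card (α := T.Tile)).trans hcard)
      ((Nat.card_eq_fintype_card (α := P.Face × ZMod 3)).trans
        (by rw [Fintype.card_prod, ZMod.card, hcard'])) hN
    refine ⟨θ 1, θ 3, θ 4, habc, AngledComplex.isomorphic_of_reindex g e (fun t i => ?_)
      hcorner hside⟩
    refine (hg t i).trans ?_
    rcases ZMod.five_cases i with rfl | rfl | rfl | rfl | rfl
    · exact h0
    · rfl
    · exact h2
    · rfl
    · rfl

/-- A tiling isomorphic to a pentagonal subdivision has the corresponding angles. -/
theorem hasAVC_of_isomorphic {α β γ δ ε a b c : ℝ} (habc : ({a, b, c} : Multiset ℝ) = {α, β, γ})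
    {P : TriangularPolyhedron} [Fintype P.Face] {n F m : ℕ}
    {opp : Equiv.Perm (P.Face × ZMod 3)} {rep : P.Vertex → P.Face × ZMod 3}
    (hP : P.IsRegular n opp rep) (hF : Fintype.card P.Face = F) (hm : 3 * F = n * m) (hn : n ≠ 0)
    (hiso : T.complex.Isomorphic (P.pentagonalSubdivision a b c δ ε)) :
    T.HasAVC ⟨3 * F, {α, β, γ, δ, ε}, Multiset.replicate (3 * F) {α, β, γ} +
      Multiset.replicate F {δ, δ, δ} + Multiset.replicate m (Multiset.replicate n ε)⟩ := by
  classical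
  set B := P.pentagonalSubdivision a b c δ ε with hBdef
  have hB : B.IsSubdivision n P.nextTile opp := hP.isSubdivision a b c δ ε
  have : Fintype B.Tile := (inferInstance : Fintype (P.Face × ZMod 3))
  obtain ⟨e, g, hangle, hcorner, -⟩ := hiso
  let θ : ZMod 5 → ℝ := ![ε, a, δ, b, c]
  have hangle' : ∀ t i, T.angle t i = θ ((g t).onCorner i) := hangle
  let g' : T.Tile → PentagonSymm := fun t => (g t).inv
  let A := T.complex.reindex g'
  have hg' : ∀ t i, T.angle t ((g' t).onCorner i) = θ i := fun t i => by
    rw [hangle', (g t).onCorner_inv]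
  have hAB : ∀ (t t' : A.Tile) i j, A.corner t i = A.corner t' j ↔
      B.corner (e t) i = B.corner (e t') j := by
    intro t t' i j
    refine (hcorner t t' _ _).trans (Eq.to_iff ?_)
    rw [(g t).onCorner_inv, (g t').onCorner_inv]
  have hlabels := AngledComplex.labels_eq_of_equiv (A := A) (B := B) e hAB
  have hcardT : Fintype.card T.Tile = 3 * F := by
    have h1 : Fintype.card (P.Face × ZMod 3) = 3 * F := by
      rw [Fintype.card_prod, ZMod.card, hF, mul_comm]
    rw [← h1]
    exact Fintype.card_congr (α := T.Tile) (β := P.Face × ZMod 3) e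
  have hkind : ∀ i j (t t' : A.Tile), A.corner t i = A.corner t' j →
      (![0, 1, 2, 1, 1] : ZMod 5 → Fin 3) i = (![0, 1, 2, 1, 1] : ZMod 5 → Fin 3) j :=
    fun i j t t' h => hB.kinds.kind_eq ((hAB _ _ _ _).1 h)
  have hncard : ∀ (t : A.Tile) k, {u | A.corner u k = A.corner t k}.ncard =
      {u | B.corner u k = B.corner (e t) k}.ncard := fun t k =>
    (AngledComplex.count_labels _ _).symm.trans
      ((congrArg (Multiset.count k) (hlabels t k)).trans (AngledComplex.count_labels _ _))
  have hn0 : ∀ t : A.Tile, {u | A.corner u 0 = A.corner t 0}.ncard = n := by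
    intro t
    rw [hncard, ← hP.ncard_vert_eq (e t)]
    congr 1
    ext u
    exact ⟨SubdivVertex.old.inj, congrArg SubdivVertex.old⟩
  have hn2 : ∀ t : A.Tile, {u | A.corner u 2 = A.corner t 2}.ncard = 3 := by
    intro t
    rw [hncard]
    have h1 : {u | B.corner u 2 = B.corner (e t) 2} =
        range fun j : ZMod 3 => (((e t).1, j) : P.Face × ZMod 3) := by
      ext u
      constructor
      · intro h
        exact ⟨u.2, Prod.ext (SubdivVertex.center.inj h).symm rfl⟩
      · rintro ⟨j, rfl⟩
        rfl
    exact (congrArg ncard h1).trans (ncard_range_mk _)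
  have hn1 : ∀ t : A.Tile, {u | A.corner u 1 = A.corner t 1}.ncard = 1 := by
    intro t
    rw [hncard, ← AngledComplex.count_labels, hB.labels_of_kind_one _ (Or.inl rfl)]
    decide
  have hl0 : ∀ t : A.Tile, A.labels (A.corner t 0) = Multiset.replicate n 0 := fun t =>
    AngledComplex.labels_eq_replicate (fun t' j h => by
      rcases ZMod.five_cases j with rfl | rfl | rfl | rfl | rfl <;>
        first | rfl | exact absurd (hkind _ _ _ _ h) (by decide)) (hn0 t)
  have hl2 : ∀ t : A.Tile, A.labels (A.corner t 2) = Multiset.replicate 3 2 := fun t =>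
    AngledComplex.labels_eq_replicate (fun t' j h => by
      rcases ZMod.five_cases j with rfl | rfl | rfl | rfl | rfl <;>
        first | rfl | exact absurd (hkind _ _ _ _ h) (by decide)) (hn2 t)
  have hl1 : ∀ t : A.Tile, A.labels (A.corner t 1) = {1, 3, 4} := fun t => by
    rw [hlabels, hB.labels_of_kind_one _ (Or.inl rfl)]
  have hv : ∀ p, T.vertexAngles p = (A.labels p).map θ := T.vertexAngles_eq_map_labels g' hg'
  -- the vertices, sorted by kind
  let V : ZMod 5 → Finset S2 := fun k => Finset.univ.image fun t : T.Tile =>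
    T.corner t ((g' t).onCorner k)
  have hVmem : ∀ k p, p ∈ V k ↔ ∃ t : A.Tile, A.corner t k = p := fun k p => by
    simp only [V, Finset.mem_image, Finset.mem_univ, true_and]
    exact Iff.rfl
  -- Double counting: each of the `3F` tiles has one corner `k`, and each vertex in `V k` receives
  -- `r` of them.
  have hVcard : ∀ k r, (∀ t : A.Tile, {u | A.corner u k = A.corner t k}.ncard = r) →
      3 * F = r * (V k).card := by
    intro k r hr
    rw [← hcardT, ← Finset.card_univ, Finset.card_eq_sum_card_image
      (fun t : T.Tile => T.corner t ((g' t).onCorner k)), mul_comm, ← smul_eq_mul]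
    refine Finset.sum_const_nat ?_
    intro p hp
    obtain ⟨t, rfl⟩ := (hVmem k p).1 hp
    exact (card_filter_eq_ncard _).trans (hr t)
  have hdisj : ∀ i j, (![0, 1, 2, 1, 1] : ZMod 5 → Fin 3) i ≠
      (![0, 1, 2, 1, 1] : ZMod 5 → Fin 3) j → Disjoint (V i) (V j) := by
    intro i j hij
    rw [Finset.disjoint_left]
    intro p hp hp'
    obtain ⟨t, rfl⟩ := (hVmem i p).1 hp
    obtain ⟨t', ht'⟩ := (hVmem j _).1 hp'
    exact hij (hkind _ _ _ _ ht'.symm)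
  have hd12 : Disjoint (V 1) (V 2) := hdisj 1 2 (by decide)
  have hd0 : Disjoint ((V 1).disjUnion (V 2) hd12) (V 0) := by
    rw [Finset.disjUnion_eq_union, Finset.disjoint_union_left]
    exact ⟨hdisj 1 0 (by decide), hdisj 2 0 (by decide)⟩
  -- Corners 3 and 4 add nothing: each of them meets a corner 1.
  have hvert : T.vertices = ((V 1).disjUnion (V 2) hd12).disjUnion (V 0) hd0 := by
    ext p
    rw [Finset.mem_disjUnion, Finset.mem_disjUnion, hVmem, hVmem, hVmem]
    constructor
    · intro hp
      rw [vertices, Finset.mem_image] at hp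
      obtain ⟨⟨t, i⟩, -, hp⟩ := hp
      obtain ⟨u, j, hp'⟩ : ∃ (u : A.Tile) (j : ZMod 5), A.corner u j = p := by
        refine ⟨t, (g t).onCorner i, ?_⟩
        show T.corner t ((g t).inv.onCorner ((g t).onCorner i)) = p
        rw [(g t).inv_onCorner]
        exact hp
      have h1 : (j = 1 ∨ j = 3 ∨ j = 4) → ∃ t, A.corner t 1 = p := by
        intro hj
        apply AngledComplex.mem_labels.1
        rw [← hp', hlabels, hB.labels_of_kind_one _ hj]
        decide
      rcases ZMod.five_cases j with rfl | rfl | rfl | rfl | rfl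
      · exact Or.inr ⟨u, hp'⟩
      · exact Or.inl (Or.inl (h1 (by decide)))
      · exact Or.inl (Or.inr ⟨u, hp'⟩)
      · exact Or.inl (Or.inl (h1 (by decide)))
      · exact Or.inl (Or.inl (h1 (by decide)))
    · intro hp
      rw [vertices, Finset.mem_image]
      rcases hp with (⟨t, ht⟩ | ⟨t, ht⟩) | ⟨t, ht⟩
      all_goals exact ⟨(t, (g' t).onCorner _), Finset.mem_univ _, ht⟩
  have hconst : ∀ k M, (∀ t : A.Tile, A.labels (A.corner t k) = M) →
      (V k).val.map T.vertexAngles = Multiset.replicate (V k).card (M.map θ) := by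
    intro k M hM
    rw [Finset.card_def, ← Multiset.map_const']
    refine Multiset.map_congr rfl fun p hp => ?_
    obtain ⟨t, rfl⟩ := (hVmem k p).1 hp
    exact (hv _).trans (congrArg _ (hM t))
  refine ⟨hcardT, fun t => ?_, ?_⟩
  · have h1 : (Finset.univ : Finset (ZMod 5)).val.map (g t).cornerEquiv = Finset.univ.val :=
      congrArg Finset.val (Finset.map_univ_equiv (g t).cornerEquiv)
    have h2 : Finset.univ.val.map (T.angle t) = Finset.univ.val.map θ := by
      have h3 : Finset.univ.val.map (T.angle t) =
          Finset.univ.val.map (θ ∘ (g t).cornerEquiv) :=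
        Multiset.map_congr rfl fun i _ => hangle' t i
      rw [h3, ← Multiset.map_map, h1]
    rw [h2]
    have h3 : Finset.univ.val.map θ = {ε} + {a} + {δ} + {b} + {c} := rfl
    have h4 : ({a} + {b} + {c} : Multiset ℝ) = {α} + {β} + {γ} := habc
    have h5 : ({α, β, γ, δ, ε} : Multiset ℝ) = {α} + {β} + {γ} + ({δ} + {ε}) := rfl
    rw [h3]
    show _ = ({α, β, γ, δ, ε} : Multiset ℝ)
    rw [h5, ← h4]
    abel
  · rw [hvert, Finset.disjUnion_val, Finset.disjUnion_val, Multiset.map_add, Multiset.map_add,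
      hconst 1 _ hl1, hconst 2 _ hl2, hconst 0 _ hl0]
    have c1 : (V 1).card = 3 * F := by have := hVcard 1 1 hn1; omega
    have c2 : (V 2).card = F := by have := hVcard 2 3 hn2; omega
    have c0 : (V 0).card = m := by
      have := hVcard 0 n hn0
      exact Nat.eq_of_mul_eq_mul_left (Nat.pos_of_ne_zero hn) (this.symm.trans hm)
    rw [c0, c1, c2, Multiset.map_replicate, Multiset.map_replicate]
    have h1 : Multiset.map θ {1, 3, 4} = {α, β, γ} := habc
    rw [h1]
    rfl

/-- No tiling by angle congruent pentagons has the angles of `AVC5A36`. -/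
theorem not_hasAVC5A36 (hT : T.AngleCongruent) {α β γ δ ε : ℝ}
    (hnd : [α, β, γ, δ, ε].Nodup) : ¬ T.HasAVC (AVC5A36 α β γ δ ε) := by
  intro hA
  have hne : Nonempty T.Tile := Fintype.card_pos_iff.1 (by
    rw [hA.card_tile]; norm_num [AVC5A36])
  obtain ⟨t₀⟩ := hne
  obtain ⟨θ, g, hg, hθ, h0, h⟩ := T.exists_reindex hT t₀ hnd (hA.tile_angles t₀)
  have hG := T.isGlued_complex.reindex g
  have hv : ∀ t i, T.vertexAngles (T.corner t i) ∈
      ([{α, β, γ}, {δ, δ, δ}, {δ, ε, ε, ε}] : List (Multiset ℝ)) := by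
    intro t i
    have := T.vertexAngles_mem hA t i
    simp only [AVC5A36, Multiset.mem_add, Multiset.mem_replicate] at this
    simp only [List.mem_cons, List.not_mem_nil, or_false]
    tauto
  -- A single vertex `δ³` suffices for the contradiction.
  obtain ⟨p, hp, hpδ⟩ : ∃ p ∈ T.vertices.val, T.vertexAngles p = {δ, δ, δ} := by
    rw [← Multiset.mem_map, hA.vertex_types]
    simp [AVC5A36]
  rw [T.vertexAngles_eq_map_labels g hg] at hpδ
  rcases h with ⟨h1, habc⟩ | ⟨h2, habc⟩
  · have hl := T.labels_mem g hg hθ [{2, 3, 4}, {1, 1, 1}, {1, 0, 0, 0}] (by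
      rw [← habc] at hv
      simpa [h0, h1] using hv)
    have hk : (T.complex.reindex g).HasKinds ![0, 0, 1, 1, 1] := by
      refine AngledComplex.hasKinds_of_labels _ hl fun M hM => ?_
      simp only [List.mem_cons, List.not_mem_nil, or_false] at hM
      rcases hM with rfl | rfl | rfl <;> constructor <;> (simp; try decide)
    have hlp : (T.complex.reindex g).labels p = {1, 1, 1} :=
      Multiset.map_injective hθ (hpδ.trans (by simp [h1]))
    obtain ⟨t, rfl⟩ := AngledComplex.mem_labels.1 (hlp ▸ (by decide) :
      (1 : ZMod 5) ∈ (T.complex.reindex g).labels p)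
    obtain ⟨t', ht'⟩ := hG.exists_corner_zero_of_adjacent hk t
    have : (0 : ZMod 5) ∈ (T.complex.reindex g).labels ((T.complex.reindex g).corner t 1) :=
      AngledComplex.mem_labels.2 ⟨t', ht'.symm⟩
    rw [hlp] at this
    exact absurd this (by decide)
  · have hl := T.labels_mem g hg hθ [{1, 3, 4}, {2, 2, 2}, {2, 0, 0, 0}] (by
      rw [← habc] at hv
      simpa [h0, h2] using hv)
    have hlp : (T.complex.reindex g).labels p = {2, 2, 2} :=
      Multiset.map_injective hθ (hpδ.trans (by simp [h2]))
    obtain ⟨t, rfl⟩ := AngledComplex.mem_labels.1 (hlp ▸ (by decide) :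
      (2 : ZMod 5) ∈ (T.complex.reindex g).labels p)
    exact hG.false_of_mixed_vertex hl t hlp

end SphereTiling

theorem theorem1 (T : SphereTiling) (hT : T.AngleCongruent) (α β γ δ ε : ℝ)
    (hdistinct : [α, β, γ, δ, ε].Nodup) :
    (T.HasAVC (AVC5A24 α β γ δ ε) ↔
      ∃ a b c : ℝ, ({a, b, c} : Multiset ℝ) = {α, β, γ} ∧
        T.complex.Isomorphic (PP8 a b c δ ε)) ∧
    (T.HasAVC (AVC5A60 α β γ δ ε) ↔
      ∃ a b c : ℝ, ({a, b, c} : Multiset ℝ) = {α, β, γ} ∧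
        T.complex.Isomorphic (PP20 a b c δ ε)) ∧
    ¬ T.HasAVC (AVC5A36 α β γ δ ε) := by
  refine ⟨⟨fun hA => ?_, ?_⟩, ⟨fun hA => ?_, ?_⟩, T.not_hasAVC5A36 hT hdistinct⟩
  · refine T.exists_isomorphic hT hdistinct octahedron_isRegular octahedron_mem_of_closed
      (fun X y z => Equiv.Perm.exists_orbit_octahedral) hA.card_tile
      (by rw [card_octahedron_face]) (by norm_num) hA.tile_angles fun t i => ?_
    have := T.vertexAngles_mem hA t i
    simp only [AVC5A24, Multiset.mem_add, Multiset.mem_replicate] at this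
    simp only [List.mem_cons, List.not_mem_nil, or_false]
    exact this.elim (fun h => h.imp And.right fun h => Or.inl h.2) fun h => Or.inr (Or.inr h.2)
  · rintro ⟨a, b, c, habc, hiso⟩
    -- `m` counts the old vertices: 3 · 8 = 4 · 6, and below 3 · 20 = 5 · 12.
    exact T.hasAVC_of_isomorphic habc octahedron_isRegular card_octahedron_face (m := 6)
      (by norm_num) (by norm_num) hiso
  · refine T.exists_isomorphic hT hdistinct icosahedron_isRegular icosahedron_mem_of_closed
      (fun X y z => Equiv.Perm.exists_orbit_icosahedral) hA.card_tile
      (by rw [card_icosahedron_face]) (by norm_num) hA.tile_angles fun t i => ?_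
    have := T.vertexAngles_mem hA t i
    simp only [AVC5A60, Multiset.mem_add, Multiset.mem_replicate] at this
    simp only [List.mem_cons, List.not_mem_nil, or_false]
    exact this.elim (fun h => h.imp And.right fun h => Or.inl h.2) fun h => Or.inr (Or.inr h.2)
  · rintro ⟨a, b, c, habc, hiso⟩
    exact T.hasAVC_of_isomorphic habc icosahedron_isRegular card_icosahedron_face (m := 12)
      (by norm_num) (by norm_num) hiso
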